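/- **Setting.** There are $N\ge 1$ users with local objectives $f_i:\mathbb{R}^d\to\mathbb{R}$, and $F=\frac1N\sum_{i=1}^N f_i$ has minimizer $\theta^*$. The BAAF algorithm with $K\ge1$ local steps, local step size $\eta_l>0$, power $P>0$, noise level $\sigma_w\ge0$ and initial model $\hat\theta^0\in\mathbb{R}^d$ performs, in each round $r=1,\dots,R$: * each user $i$ sets $\theta_{i,0}^r=\hat\theta^{r-1}$, makes the steps $\theta_{i,k}^r=\theta_{i,k-1}^r-\eta_l\,g_i(\theta_{i,k-1}^r)$, $k=1,\dots,K$, with stochastic gradients $g_i$ computed from fresh independent samples, and sets $\theta_i^r=\theta_{i,K}^r$; * the server receives $\tilde y^r=\sum_i\sqrt{\alpha^r}(\theta_i^r-\hat\theta^{r-1})+\tilde w^r$, where $\alpha^r=P/\max_i\mathbb{E}\|\theta_i^r-\hat\theta^{r-1}\|^2$ and $\tilde w^r\sim\mathcal N(0,\sigma_w^2I_d)$ is independent of the samples and of the noise of the other rounds, and forms $\tilde\theta^r=\tilde y^r/(N\sqrt{\alpha^r})+\hat\theta^{r-1}$; * the server broadcasts the MMSE estimate $\hat\theta^r=\mu^r+\frac{(\sigma^r)^2}{(\sigma^r)^2+\sigma_w^2/(\alpha^rN^2)}(\tilde\theta^r-\mu^r)$,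 where $\mu^r=\frac1N\sum_i\mu_i^r$ and $(\sigma^r)^2=\frac1{N^2}\sum_i(\sigma_i^r)^2$. The output for positive weights $w_1,\dots,w_{R+1}$ is $\bar\theta^R=\big(\sum_{r=1}^{R+1}w_r\big)^{-1}\sum_{r=1}^{R+1}w_r\hat\theta^{r-1}$. Put $\sigma_\theta=\max_{1\le r\le R}\sigma_\theta^r$ with $\sigma_\theta^r=\sigma_w^2\big/\big(1+\frac{\sigma_w^2}{\alpha^rN^2(\sigma^r)^2}\big)$ (which is $0$ if $\sigma^r=0$). **Assumptions.** Let $\beta,\mu,\sigma,M>0$, $G\ge0$, $B\ge1$. * (Prior) For each step size $0<\eta_l\le\frac1{8\beta K(1+B^2)}$ the Gaussian model used by the server is correct along the run: for each $r\le R$ there is a $\sigma$-algebra $\mathcal G_r$ contained in the one generated by $\hat\theta^0,\dots,\hat\theta^{r-1}$ such that $\mu_i^r\in\mathbb{R}^d$ is $\mathcal G_r$-measurable, $\theta_i^r-\mu_i^r$ is independent of $\mathcal G_r$ with i.i.d. $\mathcal N(0,(\sigma_i^r)^2)$ coordinates ($\sigma_i^r$ a number), and the vectors $\theta_i^r-\mu_i^r$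 of different users are uncorrelated. (With $\mathcal G_r$ trivial and $\mu_i^r$ a constant vector with equal coordinates: $\theta_i^r$ has i.i.d. $\mathcal N(\mu_i^r,(\sigma_i^r)^2)$ coordinates and different users are uncorrelated.) * (AS1) Each $f_i$ is $\beta$-smooth and $\mu$-strongly convex. * (AS2) The $g_i$ are unbiased, $\mathbb{E}[g_i(\theta)]=\nabla f_i(\theta)$, with $\mathbb{E}\|g_i(\theta)-\nabla f_i(\theta)\|^2\le\sigma^2$ for all $\theta$; and, for the step sizes above, $\mathbb{E}\|g_i(\theta_{i,k-1}^r)\|^2\le M^2$ for all $i$, $1\le k\le K$, $1\le r\le R$. * (AS3) $\frac1N\sum_i\|\nabla f_i(\theta)\|^2\le G^2+B^2\|\nabla F(\theta)\|^2$ for all $\theta$. **Theorem.** For every integer $R\ge\frac{8\beta(1+B^2)}{\mu}$ there are a step size $0<\eta_l\le\frac{1}{8\beta K(1+B^2)}$ and positive weights $w_1,\dots,w_{R+1}$ such that $F(\bar\theta^R)$ is integrable and $$\mathbb{E}[F(\bar\theta^R)]-F(\theta^*)\le\Big(\frac{3\sigma^2(1+N)}{\mu RKN}+\frac{3dM^2\sigma_\theta}{\mu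 RN^2P}\Big)\,\ell\Big(\frac{\mu^2Rd_0}{c_1}\Big)+\frac{3\beta G^2}{\mu^2R^2}\,\ell\Big(\frac{\mu^3R^2d_0}{c_2}\Big)^2+3\mu d_0\exp\Big(-\frac{\mu R}{16\beta(1+B^2)}\Big),$$ where $d_0=\|\hat\theta^0-\theta^*\|^2$, $c_1=\frac{\sigma^2(1+N)}{KN}+\frac{dM^2\sigma_\theta}{N^2P}$, $c_2=\beta G^2$, $\ell(t)=1+\log\max\{1,t\}$ (the middle term is $0$ if $G=0$), and $\sigma_\theta$ is that of the run with step size $\eta_l$. -/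

import Mathlib

open MeasureTheory ProbabilityTheory
open scoped NNReal ENNReal Gradient

/-- The parameter space `ℝ^d` with its Euclidean norm. -/
abbrev Vec (d : ℕ) : Type := EuclideanSpace ℝ (Fin d)

/-- The data of an over-the-air federated learning system with `N` users and `d` parameters.
`g i x s` is the stochastic gradient of user `i` at the point `x` computed from the random sample
`s`; `ξ r i k` is the sample that user `i` draws in round `r` for the local step from
`θ_{i,k}^r` to `θ_{i,k+1}^r`; `w r` is the additive channel noise of round `r`. Rounds are
numbered from `1`. -/
structure OTASystem (Ω Ξ : Type*) (N d : ℕ) where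
  /-- number of local steps per round -/
  K : ℕ
  /-- transmission power -/
  P : ℝ
  /-- standard deviation of the channel noise (per coordinate) -/
  σw : ℝ≥0
  /-- initial model, broadcast in the first round -/
  init : Vec d
  g : Fin N → Vec d → Ξ → Vec d
  ξ : ℕ → Fin N → ℕ → Ω → Ξ
  w : ℕ → Ω → Vec d

/-- The parameters of the Gaussian prior that the server uses for the local models of round `r`:
`mean r i` and `var r i` are the mean and the (per coordinate) variance of the model of user `i`,
relative to the information `info r`. The case in which the prior parameters are
numbers fixed in advance is `info r = ⊥`, with `mean r i` constant. -/
structure GaussianPrior (Ω : Type*) (N d : ℕ) where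
  info : ℕ → MeasurableSpace Ω
  mean : ℕ → Fin N → Ω → Vec d
  var : ℕ → Fin N → ℝ≥0

/-- `k` steps of stochastic gradient descent from `x` with step size `η`. -/
noncomputable def sgd {Ξ : Type*} {d : ℕ} (g : Vec d → Ξ → Vec d) (η : ℝ) (s : ℕ → Ξ)
    (x : Vec d) : ℕ → Vec d
  | 0 => x
  | k + 1 => sgd g η s x k - η • g (sgd g η s x k) (s k)

namespace GaussianPrior

variable {Ω : Type*} {N d : ℕ}

/-- `μ^r = (1/N) ∑ i, μ_i^r` -/
noncomputable def avgMean (p : GaussianPrior Ω N d) (r : ℕ) (ω : Ω) : Vec d :=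
  (1 / (N : ℝ)) • ∑ i, p.mean r i ω

/-- `(σ^r)^2 = (1/N^2) ∑ i, (σ_i^r)^2` -/
noncomputable def avgVar (p : GaussianPrior Ω N d) (r : ℕ) : ℝ :=
  (1 / (N : ℝ) ^ 2) * ∑ i, (p.var r i : ℝ)

end GaussianPrior

namespace OTASystem

variable {Ω Ξ : Type*} [MeasurableSpace Ω] {N d : ℕ}

/-! One communication round `r`, started by all users from the broadcast model `x`. -/

/-- `θ_{i,k}^r` -/
noncomputable def localIter (S : OTASystem Ω Ξ N d) (η : ℝ) (x : Ω → Vec d) (r : ℕ) (i : Fin N)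
    (k : ℕ) (ω : Ω) : Vec d :=
  sgd (S.g i) η (fun l => S.ξ r i l ω) (x ω) k

/-- The squared precoding factor
`α^r = P / max_i 𝔼 ‖θ_i^r - θ_{i,0}^r‖^2`, where `θ_i^r = θ_{i,K}^r`. -/
noncomputable def precoder (S : OTASystem Ω Ξ N d) (Pr : Measure Ω) (η : ℝ) (x : Ω → Vec d)
    (r : ℕ) : ℝ :=
  S.P / ⨆ i : Fin N, ∫ ω, ‖S.localIter η x r i S.K ω - x ω‖ ^ 2 ∂Pr

/-- The noisy superposition `y^r = ∑ i, √α^r (θ_i^r - θ_{i,0}^r) + w^r` received by the server. -/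
noncomputable def received (S : OTASystem Ω Ξ N d) (Pr : Measure Ω) (η : ℝ) (x : Ω → Vec d)
    (r : ℕ) (ω : Ω) : Vec d :=
  ∑ i, √(S.precoder Pr η x r) • (S.localIter η x r i S.K ω - x ω) + S.w r ω

/-- The rescaled channel output `y^r / (N √α^r) + x`. -/
noncomputable def rescaled (S : OTASystem Ω Ξ N d) (Pr : Measure Ω) (η : ℝ) (x : Ω → Vec d)
    (r : ℕ) (ω : Ω) : Vec d :=
  (1 / ((N : ℝ) * √(S.precoder Pr η x r))) • S.received Pr η x r ω + x ω

/-- The shrinkage coefficient `(σ^r)^2 / ((σ^r)^2 + σ_w^2 / (α^r N^2))`. -/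
noncomputable def shrink (S : OTASystem Ω Ξ N d) (Pr : Measure Ω) (η : ℝ) (p : GaussianPrior Ω N d)
    (x : Ω → Vec d) (r : ℕ) : ℝ :=
  p.avgVar r / (p.avgVar r + (S.σw : ℝ) ^ 2 / (S.precoder Pr η x r * (N : ℝ) ^ 2))

/-- The estimate of the average local model that the server computes in round `r`. -/
noncomputable def estimate (S : OTASystem Ω Ξ N d) (Pr : Measure Ω) (η : ℝ)
    (p : GaussianPrior Ω N d) (x : Ω → Vec d) (r : ℕ) (ω : Ω) : Vec d :=
  p.avgMean r ω + S.shrink Pr η p x r • (S.rescaled Pr η x r ω - p.avgMean r ω)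

/-! The whole run with local step size `η`. -/

/-- The global model `θ̂^r` after `r` rounds of the algorithm. -/
noncomputable def model (S : OTASystem Ω Ξ N d) (Pr : Measure Ω) (η : ℝ)
    (p : GaussianPrior Ω N d) : ℕ → Ω → Vec d
  | 0 => fun _ => S.init
  | r + 1 => S.estimate Pr η p (S.model Pr η p r) (r + 1)

/-- The local iterate `θ_{i,k}^r` of the run, in round `r ≥ 1`. -/
noncomputable def iterate (S : OTASystem Ω Ξ N d) (Pr : Measure Ω) (η : ℝ)
    (p : GaussianPrior Ω N d) (r : ℕ) (i : Fin N) (k : ℕ) : Ω → Vec d :=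
  S.localIter η (S.model Pr η p (r - 1)) r i k

/-- The channel-error quantity
`σ_θ^r = σ_w^2 / (1 + σ_w^2 / (α^r N^2 (σ^r)^2))`, written without the inner fraction, so that it
has its limit value `0` when `σ^r = 0`. -/
noncomputable def channelErr (S : OTASystem Ω Ξ N d) (Pr : Measure Ω) (η : ℝ)
    (p : GaussianPrior Ω N d) (r : ℕ) : ℝ :=
  let a := S.precoder Pr η (S.model Pr η p (r - 1)) r * (N : ℝ) ^ 2 * p.avgVar r
  (S.σw : ℝ) ^ 2 * a / (a + (S.σw : ℝ) ^ 2)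

/-- `σ_θ`, the maximum of `σ_θ^r` over the rounds `r = 1, …, R`. -/
noncomputable def maxChannelErr (S : OTASystem Ω Ξ N d) (Pr : Measure Ω) (η : ℝ)
    (p : GaussianPrior Ω N d) (R : ℕ) : ℝ :=
  ⨆ r : Fin R, S.channelErr Pr η p (r + 1)

/-- The output of the algorithm: the weighted average of `θ̂^0, …, θ̂^R` with weights
`wt 1, …, wt (R + 1)`. -/
noncomputable def output (S : OTASystem Ω Ξ N d) (Pr : Measure Ω) (η : ℝ)
    (p : GaussianPrior Ω N d) (R : ℕ) (wt : ℕ → ℝ) (ω : Ω) : Vec d :=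
  (1 / ∑ r ∈ Finset.Icc 1 (R + 1), wt r) •
    ∑ r ∈ Finset.Icc 1 (R + 1), wt r • S.model Pr η p (r - 1) ω

/-- The randomness of the system: the samples of user `i` have law `ν i`, the channel noise of
each round is `N(0, σ_w^2 I_d)`, and all samples and all noise vectors are independent. -/
structure IsRandom [MeasurableSpace Ξ] (S : OTASystem Ω Ξ N d) (Pr : Measure Ω)
    (ν : Fin N → Measure Ξ) : Prop where
  measurable_sample : ∀ r i k, Measurable (S.ξ r i k)
  measurable_noise : ∀ r, Measurable (S.w r)
  sample_law : ∀ r i k, Pr.map (S.ξ r i k) = ν i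
  noise_law : ∀ r, Pr.map (fun ω m => S.w r ω m) =
    Measure.pi (fun _ : Fin d => gaussianReal 0 (S.σw ^ 2))
  samples_indep : iIndepFun (fun (t : ℕ × Fin N × ℕ) => S.ξ t.1 t.2.1 t.2.2) Pr
  noise_indep : iIndepFun S.w Pr
  samples_noise_indep : IndepFun
    (fun ω (t : ℕ × Fin N × ℕ) => S.ξ t.1 t.2.1 t.2.2 ω) (fun ω r => S.w r ω) Pr

/-- The statistical model behind the estimator, for the first `R` rounds of the run with step size
`η`: the information used in round `r` is part of what the broadcasts `θ̂^0, …, θ̂^{r-1}` reveal;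
given this information, the coordinates of `θ_i^r` are independent Gaussian variables with mean
`mean r i` and variance `var r i` (that is, `θ_i^r - mean r i` is independent of the information
and has i.i.d. `N(0, var r i)` coordinates), and the models of different users are
uncorrelated. -/
structure PriorCorrect (S : OTASystem Ω Ξ N d) (Pr : Measure Ω) (η : ℝ)
    (p : GaussianPrior Ω N d) (R : ℕ) : Prop where
  info_le : ∀ r ∈ Finset.Icc 1 R,
    p.info r ≤ ⨆ q ∈ Finset.range r, MeasurableSpace.comap (S.model Pr η p q) inferInstance
  measurable_mean : ∀ r ∈ Finset.Icc 1 R, ∀ i, Measurable[p.info r] (p.mean r i)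
  gaussian : ∀ r ∈ Finset.Icc 1 R, ∀ i,
    Pr.map (fun ω m => S.iterate Pr η p r i S.K ω m - p.mean r i ω m) =
      Measure.pi (fun _ : Fin d => gaussianReal 0 (p.var r i))
  indep_info : ∀ r ∈ Finset.Icc 1 R, ∀ i,
    Indep (MeasurableSpace.comap (fun ω => S.iterate Pr η p r i S.K ω - p.mean r i ω)
      inferInstance) (p.info r) Pr
  uncorrelated : ∀ r ∈ Finset.Icc 1 R, ∀ i j, i ≠ j → ∀ m m' : Fin d,
    cov[fun ω => S.iterate Pr η p r i S.K ω m - p.mean r i ω m,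
      fun ω => S.iterate Pr η p r j S.K ω m' - p.mean r j ω m'; Pr] = 0

end OTASystem

/-- The global objective `F = (1/N) ∑ i, f_i`. -/
noncomputable def globalLoss {N d : ℕ} (f : Fin N → Vec d → ℝ) (x : Vec d) : ℝ :=
  (1 / (N : ℝ)) * ∑ i, f i x

/-- `f` is differentiable with `β`-Lipschitz gradient. -/
def IsSmooth {d : ℕ} (β : ℝ) (f : Vec d → ℝ) : Prop :=
  Differentiable ℝ f ∧ ∀ x y, ‖∇ f x - ∇ f y‖ ≤ β * ‖x - y‖

/-- `g` is an unbiased stochastic gradient of `f` with variance at most `σ^2`, for samples of law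
`ν`. -/
structure IsStochasticGradient {Ξ : Type*} [MeasurableSpace Ξ] {d : ℕ} (ν : Measure Ξ)
    (f : Vec d → ℝ) (g : Vec d → Ξ → Vec d) (σ : ℝ) : Prop where
  measurable : Measurable (Function.uncurry g)
  integrable : ∀ x, Integrable (g x) ν
  unbiased : ∀ x, ∫ s, g x s ∂ν = ∇ f x
  integrable_sq : ∀ x, Integrable (fun s => ‖g x s - ∇ f x‖ ^ 2) ν
  variance_le : ∀ x, ∫ s, ‖g x s - ∇ f x‖ ^ 2 ∂ν ≤ σ ^ 2

/-- Bounded gradient dissimilarity. -/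
def BoundedDissimilarity {N d : ℕ} (f : Fin N → Vec d → ℝ) (G B : ℝ) : Prop :=
  ∀ x, (1 / (N : ℝ)) * ∑ i, ‖∇ (f i) x‖ ^ 2 ≤ G ^ 2 + B ^ 2 * ‖∇ (globalLoss f) x‖ ^ 2

/-- The logarithmic factor `1 + log (max {1, t})`. -/
noncomputable def logFactor (t : ℝ) : ℝ := 1 + Real.log (max 1 t)

/-! The proof combines four observations.

* The MMSE estimate never hurts. With `u` the deviation of the average local model from the prior
  mean `μ̄`, `n` the rescaled channel noise and `s = A / (A + τ)` the shrinkage coefficient, the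
  broadcast model is `μ̄ + s (u + n)` while the exact average is `μ̄ + u`. The vectors `μ̄ - θ*`, `u`,
  `n` are orthogonal in `L²` with `E‖u‖² = d A` and `E‖n‖² = d τ`, and `s² (A + τ) = s A ≤ A`, so
  the mean squared distance of the broadcast model to `θ*` is at most that of the exact average
  (`OTASystem.integral_norm_model_succ_sub_sq_le`).

* One exact round of federated averaging, with effective step size `h = K η`, contracts the mean
  squared distance by `1 - μ h / 2`, up to a multiple of the suboptimality gap and error terms of
  order `h² σ² (1 + N) / (K N)` and `h³ β G²`
  (`FreshSamples.integral_norm_mean_local_sub_sq_le`). The drift of the local iterates is estimated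
  by comparison with exact local gradient descent: the stochastic part is driven by martingale
  differences and the deterministic part is controlled by the gradients at the starting point.
  All estimates are unconditional expectations; the only probabilistic input is that an error of
  a stochastic gradient is orthogonal to everything independent of its sample
  (`IsStochasticGradient.error_moments`).

* Weighting round `r` by `(1 - μ h / 2)⁻ʳ` makes the recursion telescope (`weighted_average_le`),
  and convexity passes from the average of the losses to the loss of the average
  (`OTASystem.integral_output_sub_le`). The last model `θ̂^R` also enters the output; a virtual
  noise-free round after it bounds its suboptimality gap.

* The resulting bound contains no channel term. The step size is therefore tuned for
  `c₁ = σ² (1 + N) / (K N)` alone (`exists_step_size`), which avoids any circular dependence between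
  the step size and `σ_θ`, and since `c ↦ c (1 + log (max {1, b / c}))` is nondecreasing
  (`mul_logFactor_mono`) the channel term may be added to `c₁` at the end. -/

/-! ### Smooth and strongly convex functions -/

section Convex

variable {d : ℕ}

theorem hasDerivAt_comp_line {f : Vec d → ℝ} (hf : Differentiable ℝ f) (x v : Vec d) (t : ℝ) :
    HasDerivAt (fun s : ℝ => f (x + s • v)) (inner ℝ (∇ f (x + t • v)) v) t := by
  have h1 : HasDerivAt (fun s : ℝ => x + s • v) v t := by
    simpa using ((hasDerivAt_id t).smul_const v).const_add x
  have h2 := (hf (x + t • v)).hasGradientAt.hasFDerivAt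
  exact h2.comp_hasDerivAt t h1

theorem StrongConvexOn.le_sub_inner_gradient {f : Vec d → ℝ} {μ : ℝ}
    (hc : StrongConvexOn Set.univ μ f) (hf : Differentiable ℝ f) (x y : Vec d) :
    f x + inner ℝ (∇ f x) (y - x) + μ / 2 * ‖x - y‖ ^ 2 ≤ f y := by
  have h1 : Filter.Tendsto (fun t : ℝ => t⁻¹ • (f (x + t • (y - x)) - f x))
      (nhdsWithin 0 (Set.Ioi 0)) (nhds (inner ℝ (∇ f x) (y - x))) := by
    have := (hasDerivAt_comp_line hf x (y - x) 0).tendsto_slope_zero_right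
    simpa using this
  have h2 : Filter.Tendsto (fun t : ℝ => f y - f x - (1 - t) * (μ / 2 * ‖x - y‖ ^ 2))
      (nhdsWithin 0 (Set.Ioi 0)) (nhds (f y - f x - (1 - 0) * (μ / 2 * ‖x - y‖ ^ 2))) := by
    refine Filter.Tendsto.mono_left ?_ nhdsWithin_le_nhds
    exact Continuous.tendsto (by fun_prop) 0
  have h3 := le_of_tendsto_of_tendsto h1 h2 ?_
  · linarith
  · filter_upwards [Ioo_mem_nhdsGT (zero_lt_one' ℝ)] with t ht
    have h4 := hc.2 (Set.mem_univ x) (Set.mem_univ y) (sub_nonneg.2 ht.2.le) ht.1.le (by ring)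
    have h5 : (1 - t) • x + t • y = x + t • (y - x) := by module
    rw [h5] at h4
    simp only [smul_eq_mul] at h4 ⊢
    rw [inv_mul_le_iff₀ ht.1]
    linarith

theorem IsSmooth.le_add_inner_gradient {f : Vec d → ℝ} {β : ℝ} (hf : IsSmooth β f)
    (x y : Vec d) : f y ≤ f x + inner ℝ (∇ f x) (y - x) + β / 2 * ‖x - y‖ ^ 2 := by
  set v := y - x with hv
  have hder : ∀ t : ℝ, HasDerivAt
      (fun s : ℝ => f (x + s • v) - s * inner ℝ (∇ f x) v - β / 2 * ‖v‖ ^ 2 * s ^ 2)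
      (inner ℝ (∇ f (x + t • v)) v - inner ℝ (∇ f x) v - β * ‖v‖ ^ 2 * t) t := by
    intro t
    have h1 := hasDerivAt_comp_line hf.1 x v t
    have h2 := (hasDerivAt_id t).mul_const (inner ℝ (∇ f x) v)
    have h3 := ((hasDerivAt_id t).pow 2).const_mul (β / 2 * ‖v‖ ^ 2)
    refine ((h1.sub h2).sub h3).congr_deriv ?_
    simp; ring
  have hanti : AntitoneOn
      (fun s : ℝ => f (x + s • v) - s * inner ℝ (∇ f x) v - β / 2 * ‖v‖ ^ 2 * s ^ 2)
      (Set.Icc 0 1) := by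
    refine antitoneOn_of_deriv_nonpos (convex_Icc 0 1)
      (fun t _ => (hder t).continuousAt.continuousWithinAt)
      (fun t _ => (hder t).differentiableAt.differentiableWithinAt) ?_
    intro t ht
    rw [interior_Icc] at ht
    rw [(hder t).deriv, ← inner_sub_left]
    have h1 := real_inner_le_norm (∇ f (x + t • v) - ∇ f x) v
    have h2 := hf.2 (x + t • v) x
    rw [add_sub_cancel_left, norm_smul, Real.norm_of_nonneg ht.1.le] at h2
    have h3 := mul_le_mul_of_nonneg_right h2 (norm_nonneg v)
    nlinarith
  have h := hanti (Set.left_mem_Icc.2 zero_le_one) (Set.right_mem_Icc.2 zero_le_one) zero_le_one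
  simp only [one_smul, zero_smul, add_zero, one_pow, mul_one, one_mul, zero_mul, sub_zero,
    ne_eq, OfNat.ofNat_ne_zero, not_false_eq_true, zero_pow, mul_zero] at h
  rw [hv, add_sub_cancel, ← hv] at h
  rw [norm_sub_rev x y]
  linarith

theorem IsSmooth.continuous_gradient {f : Vec d → ℝ} {β : ℝ} (hf : IsSmooth β f) :
    Continuous (∇ f) :=
  (LipschitzWith.of_dist_le' (K := β) fun x y => by
    simpa [dist_eq_norm] using hf.2 x y).continuous

theorem IsSmooth.norm_gradient_sq_le {f : Vec d → ℝ} {β : ℝ} (hf : IsSmooth β f) (hβ : 0 < β)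
    {z : Vec d} (hz : ∀ x, f z ≤ f x) (x : Vec d) : ‖∇ f x‖ ^ 2 ≤ 2 * β * (f x - f z) := by
  have h1 := hf.le_add_inner_gradient x (x - (1 / β) • ∇ f x)
  have h2 := hz (x - (1 / β) • ∇ f x)
  rw [sub_sub_cancel_left, sub_sub_cancel, inner_neg_right, inner_smul_right,
    real_inner_self_eq_norm_sq, norm_smul, Real.norm_of_nonneg (by positivity), mul_pow] at h1
  have h3 : β / 2 * ((1 / β) ^ 2 * ‖∇ f x‖ ^ 2) = 1 / (2 * β) * ‖∇ f x‖ ^ 2 := by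
    field_simp
  have h4 : 1 / β * ‖∇ f x‖ ^ 2 = 2 * (1 / (2 * β) * ‖∇ f x‖ ^ 2) := by
    field_simp
  have h5 : 1 / (2 * β) * ‖∇ f x‖ ^ 2 ≤ f x - f z := by linarith
  rw [one_div, inv_mul_le_iff₀ (by positivity)] at h5
  exact h5

/-- The strong convexity modulus of a smooth function is at most its smoothness constant; the
space has to be nontrivial. -/
theorem StrongConvexOn.modulus_le [NeZero d] {f : Vec d → ℝ} {β μ : ℝ}
    (hc : StrongConvexOn Set.univ μ f) (hf : IsSmooth β f) : μ ≤ β := by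
  obtain ⟨v, hv⟩ := exists_ne (0 : Vec d)
  have h1 := hc.le_sub_inner_gradient hf.1 0 v
  have h2 := hf.le_add_inner_gradient 0 v
  have h3 : 0 < ‖(0 : Vec d) - v‖ ^ 2 := by
    have : 0 < ‖v‖ := norm_pos_iff.2 hv
    rw [zero_sub, norm_neg]; positivity
  nlinarith

/-- First-order lower bound for a gradient taken at a perturbed point `y`: compared with the bound
for the gradient at `x`, half of the strong convexity term is lost, together with a multiple of the
squared perturbation. -/
theorem perturbed_strong_convexity {f : Vec d → ℝ} {β μ : ℝ}
    (hc : StrongConvexOn Set.univ μ f) (hf : IsSmooth β f) (hμ : 0 ≤ μ) (x y z : Vec d) :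
    f x - f z + μ / 4 * ‖x - z‖ ^ 2 - (β + μ) / 2 * ‖y - x‖ ^ 2 ≤ inner ℝ (∇ f y) (x - z) := by
  have h1 := hf.le_add_inner_gradient y x
  have h2 := hc.le_sub_inner_gradient hf.1 y z
  have h3 : inner ℝ (∇ f y) (x - z) = inner ℝ (∇ f y) (x - y) - inner ℝ (∇ f y) (z - y) := by
    rw [← inner_sub_right, sub_sub_sub_cancel_right]
  have h4 : ‖x - z‖ ≤ ‖y - x‖ + ‖y - z‖ := by
    rw [norm_sub_rev y x]; exact norm_sub_le_norm_sub_add_norm_sub x y z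
  have h5 : ‖x - z‖ ^ 2 ≤ 2 * ‖y - x‖ ^ 2 + 2 * ‖y - z‖ ^ 2 := by
    nlinarith [norm_nonneg (x - z), sq_nonneg (‖y - x‖ - ‖y - z‖)]
  rw [h3]
  nlinarith

theorem globalLoss_hasGradientAt {N : ℕ} {f : Fin N → Vec d → ℝ}
    (hf : ∀ i, Differentiable ℝ (f i)) (x : Vec d) :
    HasGradientAt (globalLoss f) ((1 / (N : ℝ)) • ∑ i, ∇ (f i) x) x := by
  have h : HasFDerivAt (globalLoss f)
      ((1 / (N : ℝ)) • ∑ i, (InnerProductSpace.toDual ℝ (Vec d)) (∇ (f i) x)) x := by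
    unfold globalLoss
    exact (HasFDerivAt.fun_sum fun i _ => (hf i x).hasGradientAt.hasFDerivAt).const_mul _
  rw [hasGradientAt_iff_hasFDerivAt]
  simpa using h

theorem gradient_globalLoss {N : ℕ} {f : Fin N → Vec d → ℝ}
    (hf : ∀ i, Differentiable ℝ (f i)) (x : Vec d) :
    ∇ (globalLoss f) x = (1 / (N : ℝ)) • ∑ i, ∇ (f i) x :=
  (globalLoss_hasGradientAt hf x).gradient

theorem IsSmooth.globalLoss {N : ℕ} (hN : 0 < N) {f : Fin N → Vec d → ℝ} {β : ℝ}
    (hf : ∀ i, IsSmooth β (f i)) : IsSmooth β (globalLoss f) := by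
  refine ⟨fun x => (globalLoss_hasGradientAt (fun i => (hf i).1) x).differentiableAt,
    fun x y => ?_⟩
  have hN' : (0 : ℝ) < N := by exact_mod_cast hN
  rw [gradient_globalLoss (fun i => (hf i).1), gradient_globalLoss (fun i => (hf i).1),
    ← smul_sub, ← Finset.sum_sub_distrib, norm_smul, Real.norm_of_nonneg (by positivity),
    one_div, inv_mul_le_iff₀ hN']
  refine (norm_sum_le _ _).trans ((Finset.sum_le_sum fun i _ => (hf i).2 x y).trans ?_)
  simp

theorem convexOn_globalLoss {N : ℕ} {f : Fin N → Vec d → ℝ}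
    (hf : ∀ i, ConvexOn ℝ Set.univ (f i)) : ConvexOn ℝ Set.univ (globalLoss f) := by
  have h : ConvexOn ℝ Set.univ (∑ i, f i) :=
    Finset.sum_induction _ (ConvexOn ℝ Set.univ) (fun _ _ => ConvexOn.add)
      (convexOn_const 0 convex_univ) fun i _ => hf i
  have := h.smul (c := 1 / (N : ℝ)) (by positivity)
  refine this.congr fun x _ => ?_
  simp [_root_.globalLoss]

end Convex

/-! ### Unrolling the recursion and tuning the step size -/

section Tuning

theorem logFactor_one_le (t : ℝ) : 1 ≤ logFactor t := by
  have := Real.log_nonneg (le_max_left 1 t)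
  unfold logFactor; linarith

theorem logFactor_nonneg (t : ℝ) : 0 ≤ logFactor t := zero_le_one.trans (logFactor_one_le t)

/-- `c ↦ c (1 + log (max {1, b / c}))` is nondecreasing. -/
theorem mul_logFactor_mono {b c c' : ℝ} (hc : 0 < c) (hcc : c ≤ c') :
    c * logFactor (b / c) ≤ c' * logFactor (b / c') := by
  have hc' : 0 < c' := hc.trans_le hcc
  rcases le_total b c with hbc | hbc
  · have h1 : logFactor (b / c) = 1 := by
      rw [logFactor, max_eq_left ((div_le_one hc).2 hbc)]; simp
    rw [h1]
    nlinarith [logFactor_one_le (b / c')]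
  · have hb : 0 < b := hc.trans_le hbc
    have h1 : logFactor (b / c) = 1 + Real.log (b / c) := by
      rw [logFactor, max_eq_right ((one_le_div hc).2 hbc)]
    have h2 : Real.log (b / c) = Real.log (b / c') + Real.log (c' / c) := by
      rw [← Real.log_mul (by positivity) (by positivity)]
      congr 1; field_simp
    have h3 : Real.log (c' / c) ≤ c' / c - 1 := Real.log_le_sub_one_of_pos (by positivity)
    have h4 : c * Real.log (c' / c) ≤ c' - c := by
      calc c * Real.log (c' / c) ≤ c * (c' / c - 1) := by gcongr
        _ = c' - c := by field_simp
    have h5 : Real.log (b / c') ≤ Real.log (max 1 (b / c')) :=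
      Real.log_le_log (by positivity) (le_max_right _ _)
    have h6 := Real.log_nonneg (le_max_left 1 (b / c'))
    rw [h1, h2, logFactor]
    nlinarith

theorem exp_neg_logFactor_le {t : ℝ} (ht : 0 < t) :
    Real.exp (-logFactor t) ≤ 1 / 2 * t⁻¹ := by
  have h1 : Real.exp (-logFactor t) = Real.exp (-1) * (max 1 t)⁻¹ := by
    rw [logFactor, neg_add, Real.exp_add, Real.exp_neg (Real.log _),
      Real.exp_log (lt_of_lt_of_le one_pos (le_max_left _ _))]
  have h2 : Real.exp (-1) ≤ 1 / 2 := by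
    rw [Real.exp_neg, inv_le_comm₀ (Real.exp_pos _) (by norm_num)]
    have := Real.add_one_le_exp 1
    norm_num at this ⊢; linarith
  rw [h1]
  gcongr
  exact le_max_right _ _

theorem weighted_sum_le_of_recursion {q δ E : ℝ} (hq : 0 < q) {a D : ℕ → ℝ} {n : ℕ}
    (hrec : ∀ r < n, a (r + 1) ≤ q * a r - δ * D r + E) :
    δ * ∑ r ∈ Finset.Icc 1 n, q⁻¹ ^ r * D (r - 1) + q⁻¹ ^ n * a n
      ≤ a 0 + E * ∑ r ∈ Finset.Icc 1 n, q⁻¹ ^ r := by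
  induction n with
  | zero => simp
  | succ n ih =>
    have h1 := ih fun r hr => hrec r (hr.trans (Nat.lt_succ_self n))
    have h2 := mul_le_mul_of_nonneg_left (hrec n (Nat.lt_succ_self n))
      (by positivity : 0 ≤ q⁻¹ ^ (n + 1))
    have h3 : q⁻¹ ^ (n + 1) * (q * a n - δ * D n + E)
        = q⁻¹ ^ n * a n - δ * (q⁻¹ ^ (n + 1) * D n) + E * q⁻¹ ^ (n + 1) := by
      rw [pow_succ]; field_simp
    rw [Finset.sum_Icc_succ_top (by omega), Finset.sum_Icc_succ_top (by omega),
      Nat.add_sub_cancel, mul_add, mul_add]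
    linarith

/-- With weights `q⁻ʳ`, `q = 1 - μ h / 2`, a contraction by the factor `q` per round bounds the
weighted average of the suboptimality gaps. The initial distance enters with the factor
`1 / ((29/20) h ∑ q⁻ʳ)`, which is at most `(9/10) μ exp (-μ h R / 2)` as soon as
`μ h R ≥ 1`. -/
theorem weighted_average_le {μ h E : ℝ} {R : ℕ} (hμ : 0 < μ) (hh : 0 < h) (hμh : μ * h < 2)
    (hR : 1 ≤ μ * h * R) {a D : ℕ → ℝ} (ha0 : 0 ≤ a 0) (han : 0 ≤ a (R + 1))
    (hrec : ∀ r < R + 1, a (r + 1) ≤ (1 - μ * h / 2) * a r - 29 / 20 * h * D r + E) :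
    (∑ r ∈ Finset.Icc 1 (R + 1), (1 - μ * h / 2)⁻¹ ^ r * D (r - 1)) /
        ∑ r ∈ Finset.Icc 1 (R + 1), (1 - μ * h / 2)⁻¹ ^ r
      ≤ 9 / 10 * μ * a 0 * Real.exp (-(μ * h * R / 2)) + 20 / 29 * (E / h) := by
  set q := 1 - μ * h / 2 with hq
  have hq0 : 0 < q := by rw [hq]; linarith
  set W := ∑ r ∈ Finset.Icc 1 (R + 1), q⁻¹ ^ r with hW
  set T := ∑ r ∈ Finset.Icc 1 (R + 1), q⁻¹ ^ r * D (r - 1) with hT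
  set z := μ * h * R / 2 with hz
  have h1 := weighted_sum_le_of_recursion hq0 hrec
  have h1' : 29 / 20 * h * T ≤ a 0 + E * W := by
    have : 0 ≤ q⁻¹ ^ (R + 1) * a (R + 1) := by positivity
    linarith
  have hWpos : 0 < W := Finset.sum_pos (fun r _ => by positivity) ⟨1, by simp⟩
  have hgeom : ∀ n : ℕ, (1 - q) * ∑ r ∈ Finset.Icc 1 n, q⁻¹ ^ r = q⁻¹ ^ n - 1 := by
    intro n
    induction n with
    | zero => simp
    | succ n ih =>
      rw [Finset.sum_Icc_succ_top (by omega), mul_add, ih, pow_succ]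
      field_simp; ring
  have hgW := hgeom (R + 1)
  have hqe : Real.exp (μ * h / 2) ≤ q⁻¹ := by
    rw [le_inv_comm₀ (Real.exp_pos _) hq0, ← Real.exp_neg]
    have := Real.add_one_le_exp (-(μ * h / 2)); rw [hq]; linarith
  have hQ : Real.exp z ≤ q⁻¹ ^ (R + 1) := by
    calc Real.exp z = Real.exp (μ * h / 2) ^ R := by
          rw [← Real.exp_nat_mul, hz]; congr 1; ring
      _ ≤ Real.exp (μ * h / 2) ^ (R + 1) :=
          pow_le_pow_right₀ (Real.one_le_exp (by positivity)) (Nat.le_succ R)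
      _ ≤ q⁻¹ ^ (R + 1) := by gcongr
  have hzge : 1 / 2 ≤ z := by rw [hz]; linarith
  have hez : 13 / 8 ≤ Real.exp z := by
    have := Real.quadratic_le_exp_of_nonneg (by linarith : 0 ≤ z)
    nlinarith
  have hgW' : μ * h / 2 * W = q⁻¹ ^ (R + 1) - 1 := by rw [← hgW, hq]; ring
  have hkey : 1 ≤ 9 / 10 * μ * Real.exp (-z) * (29 / 20 * h * W) := by
    have h2 : 9 / 10 * μ * Real.exp (-z) * (29 / 20 * h * W)
        = 261 / 100 * (Real.exp (-z) * (μ * h / 2 * W)) := by ring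
    have h3 : 5 / 13 * Real.exp z ≤ μ * h / 2 * W := by rw [hgW']; linarith
    have h4 : 5 / 13 ≤ Real.exp (-z) * (μ * h / 2 * W) := by
      calc (5 / 13 : ℝ) = Real.exp (-z) * (5 / 13 * Real.exp z) := by
            rw [Real.exp_neg]; field_simp
        _ ≤ _ := by gcongr
    rw [h2]; linarith
  have hx := mul_le_mul_of_nonneg_left hkey ha0
  rw [div_le_iff₀ hWpos]
  have h5 : T ≤ 20 / 29 / h * (a 0 + E * W) := by
    rw [div_mul_eq_mul_div, le_div_iff₀ hh]; linarith
  refine h5.trans ?_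
  have h6 : 20 / 29 / h * (a 0 + E * W) = 20 / 29 / h * a 0 + 20 / 29 * (E / h) * W := by
    field_simp
  rw [h6, add_mul]
  refine add_le_add ?_ le_rfl
  calc 20 / 29 / h * a 0 ≤ 20 / 29 / h *
        (a 0 * (9 / 10 * μ * Real.exp (-z) * (29 / 20 * h * W))) := by
        gcongr; linarith
    _ = _ := by field_simp

/-- The choice of the effective step size `h`: the smaller of the largest admissible step and
`2 L / (μ R)`, where `L` is the smaller of the two logarithmic factors (the first one if
`c₂ = 0`). -/
theorem exists_step_size {μ R d₀ c₁ c₂ hmax : ℝ} (hμ : 0 < μ) (hR : 0 < R) (hd : 0 ≤ d₀)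
    (hc₁ : 0 < c₁) (hc₂ : 0 ≤ c₂) (hmaxR : 1 ≤ μ * hmax * R) :
    ∃ h, 0 < h ∧ h ≤ hmax ∧ 1 ≤ μ * h * R ∧
      9 / 10 * μ * d₀ * Real.exp (-(μ * h * R / 2))
          + 20 / 29 * (17 / 10 * c₁ * h + 23 / 25 * c₂ * h ^ 2)
        ≤ 3 * c₁ / (μ * R) * logFactor (μ ^ 2 * R * d₀ / c₁)
          + 3 * c₂ / (μ ^ 2 * R ^ 2) * logFactor (μ ^ 3 * R ^ 2 * d₀ / c₂) ^ 2
          + 3 * μ * d₀ * Real.exp (-(μ * hmax * R / 2)) := by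
  set l₁ := logFactor (μ ^ 2 * R * d₀ / c₁) with hl₁
  set l₂ := logFactor (μ ^ 3 * R ^ 2 * d₀ / c₂) with hl₂
  have h1l₁ : 1 ≤ l₁ := logFactor_one_le _
  have h1l₂ : 1 ≤ l₂ := logFactor_one_le _
  have hμR : 0 < μ * R := by positivity
  have hmax0 : 0 < hmax := by
    by_contra hcon
    have : μ * hmax * R ≤ 0 := by
      have := mul_nonneg hμR.le (neg_nonneg.2 (not_lt.1 hcon)); linarith
    linarith
  have hexp₁ : μ * d₀ * Real.exp (-l₁) ≤ 1 / 2 * (c₁ / (μ * R)) := by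
    rcases hd.eq_or_lt with rfl | hd
    · simp; positivity
    · have := exp_neg_logFactor_le (t := μ ^ 2 * R * d₀ / c₁) (by positivity)
      calc μ * d₀ * Real.exp (-l₁) ≤ μ * d₀ * (1 / 2 * (μ ^ 2 * R * d₀ / c₁)⁻¹) := by gcongr
        _ = _ := by field_simp
  have hexp₂ : 0 < c₂ → μ * d₀ * Real.exp (-l₂) ≤ 1 / 2 * (c₂ / (μ ^ 2 * R ^ 2)) := by
    intro hc
    rcases hd.eq_or_lt with rfl | hd
    · simp; positivity
    · have := exp_neg_logFactor_le (t := μ ^ 3 * R ^ 2 * d₀ / c₂) (by positivity)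
      calc μ * d₀ * Real.exp (-l₂) ≤ μ * d₀ * (1 / 2 * (μ ^ 3 * R ^ 2 * d₀ / c₂)⁻¹) := by gcongr
        _ = _ := by field_simp
  obtain ⟨L, hL1, hLl₁, hLl₂, hLexp⟩ : ∃ L, 1 ≤ L ∧ L ≤ l₁ ∧ (0 < c₂ → L ≤ l₂) ∧
      μ * d₀ * Real.exp (-L) ≤ 1 / 2 * (c₁ / (μ * R)) + 1 / 2 * (c₂ / (μ ^ 2 * R ^ 2)) := by
    have hp₁ : 0 ≤ c₁ / (μ * R) := by positivity
    have hp₂ : 0 ≤ c₂ / (μ ^ 2 * R ^ 2) := by positivity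
    rcases hc₂.eq_or_lt with hc | hc
    · exact ⟨l₁, h1l₁, le_rfl, fun h => absurd h (by rw [← hc]; simp), by linarith⟩
    · rcases le_total l₁ l₂ with hl | hl
      · exact ⟨l₁, h1l₁, le_rfl, fun _ => hl, by linarith⟩
      · exact ⟨l₂, h1l₂, hl, fun _ => le_rfl, by linarith [hexp₂ hc]⟩
  -- the two stochastic terms, for any step size up to `2 L / (μ R)`
  have hterms : ∀ h, 0 < h → h ≤ 2 * L / (μ * R) →
      20 / 29 * (17 / 10 * c₁ * h + 23 / 25 * c₂ * h ^ 2)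
        ≤ 68 / 29 * (c₁ / (μ * R)) * l₁ + 368 / 145 * (c₂ / (μ ^ 2 * R ^ 2)) * l₂ ^ 2 := by
    intro h hh hle
    have e₁ : c₁ * h ≤ 2 * (c₁ / (μ * R)) * l₁ := by
      calc c₁ * h ≤ c₁ * (2 * l₁ / (μ * R)) := by
            gcongr; exact hle.trans (by gcongr)
        _ = _ := by field_simp
    have e₂ : c₂ * h ^ 2 ≤ 4 * (c₂ / (μ ^ 2 * R ^ 2)) * l₂ ^ 2 := by
      rcases hc₂.eq_or_lt with hc | hc
      · simp [← hc]
      · have := hLl₂ hc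
        calc c₂ * h ^ 2 ≤ c₂ * (2 * l₂ / (μ * R)) ^ 2 := by
              gcongr; exact hle.trans (by gcongr)
          _ = _ := by field_simp; ring
    linarith
  have hpos₁ : c₁ / (μ * R) ≤ c₁ / (μ * R) * l₁ := le_mul_of_one_le_right (by positivity) h1l₁
  have hpos₂ : c₂ / (μ ^ 2 * R ^ 2) ≤ c₂ / (μ ^ 2 * R ^ 2) * l₂ ^ 2 :=
    le_mul_of_one_le_right (by positivity) (one_le_pow₀ h1l₂)
  have hnn₁ : 0 ≤ c₁ / (μ * R) := by positivity
  have hnn₂ : 0 ≤ c₂ / (μ ^ 2 * R ^ 2) := by positivity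
  have hrw : 3 * c₁ / (μ * R) * l₁ + 3 * c₂ / (μ ^ 2 * R ^ 2) * l₂ ^ 2
      = 3 * (c₁ / (μ * R) * l₁) + 3 * (c₂ / (μ ^ 2 * R ^ 2) * l₂ ^ 2) := by ring
  have hE : 0 ≤ μ * d₀ * Real.exp (-(μ * hmax * R / 2)) := by positivity
  rw [hrw]
  rcases le_total hmax (2 * L / (μ * R)) with hle | hle
  · refine ⟨hmax, hmax0, le_rfl, hmaxR, ?_⟩
    have := hterms hmax hmax0 hle
    linarith
  · refine ⟨2 * L / (μ * R), by positivity, hle, ?_, ?_⟩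
    · have : μ * (2 * L / (μ * R)) * R = 2 * L := by field_simp
      linarith
    · have := hterms _ (by positivity) le_rfl
      have hz : μ * (2 * L / (μ * R)) * R / 2 = L := by field_simp
      rw [hz]
      linarith

end Tuning

/-! ### Independence and second moments -/

section Probability

variable {Ω : Type*} {d : ℕ}

theorem indep_sup_right_of_indep_sup_left {m₁ m₂ m₃ : MeasurableSpace Ω}
    [mΩ : MeasurableSpace Ω] {Pr : Measure Ω} [IsProbabilityMeasure Pr]
    (h₁ : m₁ ≤ mΩ) (h₂ : m₂ ≤ mΩ) (h₃ : m₃ ≤ mΩ) (h12 : Indep m₁ m₂ Pr)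
    (h123 : Indep (m₁ ⊔ m₂) m₃ Pr) : Indep m₁ (m₂ ⊔ m₃) Pr := by
  set p : Set (Set Ω) :=
    {t | ∃ A B, MeasurableSet[m₂] A ∧ MeasurableSet[m₃] B ∧ t = A ∩ B} with hp
  have hpi : IsPiSystem p := by
    rintro _ ⟨A, B, hA, hB, rfl⟩ _ ⟨A', B', hA', hB', rfl⟩ -
    exact ⟨A ∩ A', B ∩ B', hA.inter hA', hB.inter hB', Set.inter_inter_inter_comm _ _ _ _⟩
  have hgen : m₂ ⊔ m₃ = MeasurableSpace.generateFrom p := by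
    apply le_antisymm
    · refine sup_le (fun t ht => ?_) fun t ht => ?_
      · exact MeasurableSpace.measurableSet_generateFrom
          ⟨t, Set.univ, ht, MeasurableSet.univ, (Set.inter_univ t).symm⟩
      · exact MeasurableSpace.measurableSet_generateFrom
          ⟨Set.univ, t, MeasurableSet.univ, ht, (Set.univ_inter t).symm⟩
    · refine MeasurableSpace.generateFrom_le ?_
      rintro _ ⟨A, B, hA, hB, rfl⟩
      have hA' : MeasurableSet[m₂ ⊔ m₃] A := (le_sup_left : m₂ ≤ m₂ ⊔ m₃) A hA
      have hB' : MeasurableSet[m₂ ⊔ m₃] B := (le_sup_right : m₃ ≤ m₂ ⊔ m₃) B hB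
      exact MeasurableSet.inter hA' hB'
  refine IndepSets.indep h₁ (sup_le h₂ h₃) (@MeasurableSpace.isPiSystem_measurableSet Ω m₁) hpi
    (@MeasurableSpace.generateFrom_measurableSet Ω m₁).symm hgen ?_
  rw [IndepSets_iff]
  rintro C _ hC ⟨A, B, hA, hB, rfl⟩
  rw [Indep_iff] at h12 h123
  have hC' : MeasurableSet[m₁ ⊔ m₂] C := (le_sup_left : m₁ ≤ m₁ ⊔ m₂) C hC
  have hA' : MeasurableSet[m₁ ⊔ m₂] A := (le_sup_right : m₂ ≤ m₁ ⊔ m₂) A hA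
  rw [← Set.inter_assoc, h123 _ _ (MeasurableSet.inter hC' hA') hB, h12 _ _ hC hA,
    h123 _ _ hA' hB, mul_assoc]

section

variable [MeasurableSpace Ω] {Pr : Measure Ω}

theorem integrable_inner_of_memLp_two {f g : Ω → Vec d} (hf : MemLp f 2 Pr) (hg : MemLp g 2 Pr) :
    Integrable (fun ω => inner ℝ (f ω) (g ω)) Pr :=
  (hf.norm.integrable_mul hg.norm).mono' (hf.1.inner hg.1)
    (Filter.Eventually.of_forall fun _ => norm_inner_le_norm _ _)

theorem integrable_norm_sq_of_memLp_two {f : Ω → Vec d} (hf : MemLp f 2 Pr) :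
    Integrable (fun ω => ‖f ω‖ ^ 2) Pr :=
  (memLp_two_iff_integrable_sq_norm hf.1).1 hf

theorem integral_norm_add_sq {f g : Ω → Vec d} (hf : MemLp f 2 Pr) (hg : MemLp g 2 Pr) :
    ∫ ω, ‖f ω + g ω‖ ^ 2 ∂Pr = ∫ ω, ‖f ω‖ ^ 2 ∂Pr + 2 * ∫ ω, inner ℝ (f ω) (g ω) ∂Pr
      + ∫ ω, ‖g ω‖ ^ 2 ∂Pr := by
  have h1 := integrable_norm_sq_of_memLp_two hf
  have h2 := integrable_norm_sq_of_memLp_two hg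
  have h3 := (integrable_inner_of_memLp_two hf hg).const_mul 2
  simp_rw [norm_add_sq_real]
  have h4 : Integrable (fun ω => ‖f ω‖ ^ 2 + 2 * inner ℝ (f ω) (g ω)) Pr := h1.add h3
  rw [integral_add h4 h2, integral_add h1 h3, integral_const_mul]

/-- Pythagoras in `L²` for finitely many pairwise orthogonal random vectors. -/
theorem integral_norm_sum_sq {ι : Type*} (s : Finset ι) {X : ι → Ω → Vec d}
    (hX : ∀ i ∈ s, MemLp (X i) 2 Pr)
    (horth : ∀ i ∈ s, ∀ j ∈ s, i ≠ j → ∫ ω, inner ℝ (X i ω) (X j ω) ∂Pr = 0) :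
    ∫ ω, ‖∑ i ∈ s, X i ω‖ ^ 2 ∂Pr = ∑ i ∈ s, ∫ ω, ‖X i ω‖ ^ 2 ∂Pr := by
  simp_rw [← real_inner_self_eq_norm_sq, sum_inner, inner_sum]
  rw [integral_finsetSum _ fun i hi => integrable_finsetSum _ fun j hj =>
    integrable_inner_of_memLp_two (hX i hi) (hX j hj)]
  refine Finset.sum_congr rfl fun i hi => ?_
  rw [integral_finsetSum _ fun j hj => integrable_inner_of_memLp_two (hX i hi) (hX j hj)]
  exact Finset.sum_eq_single_of_mem i hi fun j hj hij => horth i hi j hj hij.symm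

/-- Moments of a centred Gaussian vector with independent coordinates of variance `v`. -/
theorem gaussian_moments [IsProbabilityMeasure Pr] {U : Ω → Vec d} (hU : Measurable U) {v : ℝ≥0}
    (hlaw : Pr.map (fun ω m => U ω m) = Measure.pi (fun _ : Fin d => gaussianReal 0 v)) :
    MemLp U 2 Pr ∧ (∀ m, ∫ ω, U ω m ∂Pr = 0) ∧ ∫ ω, U ω ∂Pr = 0 ∧
      ∫ ω, ‖U ω‖ ^ 2 ∂Pr = d * v := by
  have hmeas : Measurable fun ω (m : Fin d) => U ω m := by fun_prop
  have hcoord : ∀ m, Pr.map (fun ω => U ω m) = gaussianReal 0 v := by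
    intro m
    have h1 := Measure.pi_map_eval (fun _ : Fin d => gaussianReal 0 v) m
    rw [← hlaw, Measure.map_map (measurable_pi_apply m) hmeas] at h1
    change Pr.map (fun ω => U ω m) = _ at h1
    rw [h1]; simp
  have hm : ∀ m, AEMeasurable (fun ω => U ω m) Pr := fun m => by fun_prop
  have hLp : ∀ m, MemLp (fun ω => U ω m) 2 Pr := by
    intro m
    have h1 : MemLp id 2 (Pr.map fun ω => U ω m) := by
      rw [hcoord m]; exact memLp_id_gaussianReal 2
    exact (memLp_map_measure_iff h1.1 (hm m)).1 h1
  have hmean : ∀ m, ∫ ω, U ω m ∂Pr = 0 := by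
    intro m
    have h1 := integral_map (hm m) (f := fun x : ℝ => x) (by fun_prop)
    rw [hcoord m, integral_id_gaussianReal] at h1
    exact h1.symm
  have hsq : ∀ m, ∫ ω, U ω m ^ 2 ∂Pr = v := by
    intro m
    have h1 := integral_map (hm m) (f := fun x : ℝ => x ^ 2) (by fun_prop)
    have h2 : Var[fun x : ℝ => x; gaussianReal 0 v] = v := variance_fun_id_gaussianReal
    rw [variance_eq_integral (by fun_prop), integral_id_gaussianReal] at h2
    simp only [sub_zero] at h2
    rw [hcoord m, h2] at h1
    exact h1.symm
  refine ⟨memLp_piLp_iff.2 hLp, hmean, ?_, ?_⟩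
  · ext m
    rw [eval_integral_piLp fun i => (hLp i).integrable one_le_two, hmean m]
    rfl
  · simp_rw [EuclideanSpace.real_norm_sq_eq]
    rw [integral_finsetSum _ fun m _ => (hLp m).integrable_sq]
    simp [hsq]

theorem memLp_two_of_lipschitz [IsProbabilityMeasure Pr] {φ : Vec d → Vec d} {β : ℝ}
    (hφ : ∀ x y, ‖φ x - φ y‖ ≤ β * ‖x - y‖) {Y : Ω → Vec d} (hY : MemLp Y 2 Pr) :
    MemLp (fun ω => φ (Y ω)) 2 Pr := by
  have hcont : Continuous φ := (LipschitzWith.of_dist_le' (K := β) fun x y => by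
    simpa [dist_eq_norm] using hφ x y).continuous
  have h1 : MemLp (fun ω => φ (Y ω) - φ 0) 2 Pr :=
    hY.of_le_mul ((hcont.comp_aestronglyMeasurable hY.1).sub aestronglyMeasurable_const)
      (Filter.Eventually.of_forall fun ω => by simpa using hφ (Y ω) 0)
  exact (h1.add (memLp_const (φ 0))).congr_norm
    (hcont.comp_aestronglyMeasurable hY.1) (Filter.Eventually.of_forall fun ω => by simp)

theorem IsSmooth.integrable_comp [IsProbabilityMeasure Pr] {f : Vec d → ℝ} {β : ℝ}
    (hf : IsSmooth β f) (hβ : 0 < β) {z : Vec d} (hz : ∀ x, f z ≤ f x) {Y : Ω → Vec d}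
    (hY : MemLp Y 2 Pr) : Integrable (fun ω => f (Y ω)) Pr := by
  have hgrad : ∇ f z = 0 := by
    have h := hf.norm_gradient_sq_le hβ hz z
    rw [sub_self, mul_zero] at h
    exact norm_eq_zero.1 (pow_eq_zero_iff two_ne_zero |>.1 (le_antisymm h (by positivity)))
  have h1 : Integrable (fun ω => f (Y ω) - f z) Pr := by
    refine ((integrable_norm_sq_of_memLp_two ((memLp_const z).sub hY)).const_mul (β / 2)).mono'
      ((hf.1.continuous.comp_aestronglyMeasurable hY.1).sub aestronglyMeasurable_const)
      (Filter.Eventually.of_forall fun ω => ?_)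
    have h2 := hf.le_add_inner_gradient z (Y ω)
    rw [hgrad, inner_zero_left] at h2
    rw [Real.norm_of_nonneg (sub_nonneg.2 (hz _)), Pi.sub_apply]
    linarith
  exact (h1.add (integrable_const (f z))).congr (Filter.Eventually.of_forall fun ω => by simp)

end

/-- A square-integrable centred random vector is orthogonal in `L²` to every square-integrable
random vector that is independent of it. -/
theorem integral_inner_eq_zero_of_indep {m : MeasurableSpace Ω}
    [mΩ : MeasurableSpace Ω] {Pr : Measure Ω} [IsProbabilityMeasure Pr] {U Z : Ω → Vec d}
    (hind : Indep (MeasurableSpace.comap U inferInstance) m Pr) (hZ : Measurable[m] Z)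
    (hU2 : MemLp U 2 Pr) (hZ2 : MemLp Z 2 Pr) (hU0 : ∫ ω, U ω ∂Pr = 0) :
    ∫ ω, inner ℝ (U ω) (Z ω) ∂Pr = 0 := by
  have h1 : IndepFun U Z Pr := by
    rw [IndepFun_iff_Indep]
    exact indep_of_indep_of_le_right hind hZ.comap_le
  have h2 := h1.integral_bilin (hU2.integrable one_le_two) (hZ2.integrable one_le_two)
    (innerSL ℝ)
  rw [hU0, map_zero] at h2
  exact h2

section StochasticGradient

variable {Ξ : Type*} [MeasurableSpace Ξ] {ν : Measure Ξ}

/-- A stochastic gradient evaluated with a sample `s` at a point `Y` that is independent of `s`: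
its error is square integrable, has second moment at most `σ²`, and is orthogonal in `L²` to
everything that is independent of `s`. -/
theorem IsStochasticGradient.error_moments {m : MeasurableSpace Ω}
    [mΩ : MeasurableSpace Ω] {Pr : Measure Ω} [IsProbabilityMeasure Pr] (hm : m ≤ mΩ)
    {f : Vec d → ℝ} {g : Vec d → Ξ → Vec d} {σ : ℝ}
    (hg : IsStochasticGradient ν f g σ) (hcont : Continuous (∇ f)) {s : Ω → Ξ}
    (hs : Measurable s) (hlaw : Pr.map s = ν)
    (hind : Indep (MeasurableSpace.comap s inferInstance) m Pr) {Y : Ω → Vec d}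
    (hY : Measurable[m] Y) :
    MemLp (fun ω => g (Y ω) (s ω) - ∇ f (Y ω)) 2 Pr ∧
    ∫ ω, ‖g (Y ω) (s ω) - ∇ f (Y ω)‖ ^ 2 ∂Pr ≤ σ ^ 2 ∧
    ∀ Z : Ω → Vec d, Measurable[m] Z → MemLp Z 2 Pr →
      ∫ ω, inner ℝ (g (Y ω) (s ω) - ∇ f (Y ω)) (Z ω) ∂Pr = 0 := by
  have hνp : IsProbabilityMeasure ν := hlaw ▸ Measure.isProbabilityMeasure_map hs.aemeasurable
  have hprod : ∀ {α : Type} [MeasurableSpace α] (V : Ω → α), Measurable[m] V →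
      Pr.map (fun ω => (V ω, s ω)) = (Pr.map V).prod ν := by
    intro α _ V hV
    have h1 : IndepFun V s Pr := by
      rw [IndepFun_iff_Indep]
      exact (indep_of_indep_of_le_right hind hV.comap_le).symm
    rw [(indepFun_iff_map_prod_eq_prod_map_map (hV.mono hm le_rfl).aemeasurable
      hs.aemeasurable).1 h1, hlaw]
  have hY' : Measurable Y := hY.mono hm le_rfl
  have hgm : Measurable fun z : Vec d × Ξ => g z.1 z.2 - ∇ f z.1 := by
    exact hg.measurable.sub (hcont.measurable.comp measurable_fst)
  have hYs : Measurable fun ω => (Y ω, s ω) := hY'.prodMk hs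
  have hYp : IsProbabilityMeasure (Pr.map Y) := Measure.isProbabilityMeasure_map hY'.aemeasurable
  -- Tonelli: the conditional bound on the variance integrates to an unconditional one
  have hlin : ∫⁻ ω, ENNReal.ofReal (‖g (Y ω) (s ω) - ∇ f (Y ω)‖ ^ 2) ∂Pr
      ≤ ENNReal.ofReal (σ ^ 2) := by
    have hmeas : Measurable fun z : Vec d × Ξ =>
        ENNReal.ofReal (‖g z.1 z.2 - ∇ f z.1‖ ^ 2) := (hgm.norm.pow_const 2).ennreal_ofReal
    have h1 := lintegral_map hmeas hYs (μ := Pr)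
    rw [hprod Y hY, lintegral_prod _ hmeas.aemeasurable] at h1
    rw [← h1]
    calc ∫⁻ y, ∫⁻ t, ENNReal.ofReal (‖g y t - ∇ f y‖ ^ 2) ∂ν ∂(Pr.map Y)
        ≤ ∫⁻ _, ENNReal.ofReal (σ ^ 2) ∂(Pr.map Y) := by
          refine lintegral_mono fun y => ?_
          rw [← ofReal_integral_eq_lintegral_ofReal (hg.integrable_sq y)
            (Filter.Eventually.of_forall fun t => by positivity)]
          exact ENNReal.ofReal_le_ofReal (hg.variance_le y)
      _ = ENNReal.ofReal (σ ^ 2) := by simp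
  have hζm : Measurable fun ω => g (Y ω) (s ω) - ∇ f (Y ω) := hgm.comp hYs
  have hint : Integrable (fun ω => ‖g (Y ω) (s ω) - ∇ f (Y ω)‖ ^ 2) Pr := by
    refine ⟨(hζm.norm.pow_const 2).aestronglyMeasurable, ?_⟩
    rw [hasFiniteIntegral_iff_ofReal (Filter.Eventually.of_forall fun t => by positivity)]
    exact hlin.trans_lt ENNReal.ofReal_lt_top
  have hζ2 : MemLp (fun ω => g (Y ω) (s ω) - ∇ f (Y ω)) 2 Pr :=
    (memLp_two_iff_integrable_sq_norm hζm.aestronglyMeasurable).2 hint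
  refine ⟨hζ2, ?_, ?_⟩
  · rw [← ofReal_integral_eq_lintegral_ofReal hint
      (Filter.Eventually.of_forall fun t => by positivity)] at hlin
    exact (ENNReal.ofReal_le_ofReal_iff (sq_nonneg σ)).1 hlin
  · intro Z hZ hZ2
    have hZ' : Measurable Z := hZ.mono hm le_rfl
    have hV : Measurable[m] fun ω => (Y ω, Z ω) := hY.prodMk hZ
    have hV' : Measurable fun ω => (Y ω, Z ω) := hY'.prodMk hZ'
    have hmeas : Measurable fun z : (Vec d × Vec d) × Ξ =>
        (inner ℝ (g z.1.1 z.2 - ∇ f z.1.1) z.1.2 : ℝ) :=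
      (hgm.comp ((measurable_fst.comp measurable_fst).prodMk measurable_snd)).inner
        (measurable_snd.comp measurable_fst)
    have h1 := integral_map (μ := Pr) (hV'.prodMk hs).aemeasurable
      (f := fun z : (Vec d × Vec d) × Ξ =>
        (inner ℝ (g z.1.1 z.2 - ∇ f z.1.1) z.1.2 : ℝ)) hmeas.aestronglyMeasurable
    have hint2 : Integrable (fun z : (Vec d × Vec d) × Ξ =>
        (inner ℝ (g z.1.1 z.2 - ∇ f z.1.1) z.1.2 : ℝ))
        ((Pr.map fun ω => (Y ω, Z ω)).prod ν) := by
      rw [← hprod _ hV]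
      exact (integrable_map_measure hmeas.aestronglyMeasurable
        (hV'.prodMk hs).aemeasurable).2 (integrable_inner_of_memLp_two hζ2 hZ2)
    rw [hprod _ hV, integral_prod _ hint2] at h1
    rw [← h1]
    refine integral_eq_zero_of_ae (Filter.Eventually.of_forall fun z => ?_)
    have h2 : ∀ t, (inner ℝ (g z.1 t - ∇ f z.1) z.2 : ℝ)
        = inner ℝ z.2 (g z.1 t - ∇ f z.1) := fun t => real_inner_comm _ _
    simp only [h2]
    have hi : Integrable (fun t => g z.1 t - ∇ f z.1) ν :=
      (hg.integrable z.1).sub (integrable_const _)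
    rw [integral_inner hi, integral_sub (hg.integrable z.1) (integrable_const _),
      hg.unbiased]
    simp

end StochasticGradient

end Probability

/-! ### Deterministic estimates for one round of local gradient steps -/

section Deterministic

variable {d : ℕ}

theorem sgd_eq_sub_sum {Ξ : Type*} (g : Vec d → Ξ → Vec d) (η : ℝ) (s : ℕ → Ξ) (x : Vec d)
    (k : ℕ) : sgd g η s x k = x - η • ∑ l ∈ Finset.range k, g (sgd g η s x l) (s l) := by
  induction k with
  | zero => simp [sgd]
  | succ k ih =>
    rw [Finset.sum_range_succ, smul_add, ← sub_sub, ← ih]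
    rfl

/-- `k` steps of exact gradient descent for `f` from `x` with step size `η`. -/
noncomputable def gradDescent (f : Vec d → ℝ) (η : ℝ) (x : Vec d) (k : ℕ) : Vec d :=
  (fun y => y - η • ∇ f y)^[k] x

theorem gradDescent_succ (f : Vec d → ℝ) (η : ℝ) (x : Vec d) (k : ℕ) :
    gradDescent f η x (k + 1) = gradDescent f η x k - η • ∇ f (gradDescent f η x k) :=
  Function.iterate_succ_apply' _ _ _

theorem IsSmooth.norm_gradDescent_sub_le {f : Vec d → ℝ} {β η : ℝ} (hf : IsSmooth β f)
    (hβ : 0 ≤ β) (hη : 0 ≤ η) (x : Vec d) (k : ℕ) :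
    ‖gradDescent f η x k - x‖ ≤ (1 + η * β) ^ k * (k * (η * ‖∇ f x‖)) := by
  have hρ : 1 ≤ 1 + η * β := by nlinarith [mul_nonneg hη hβ]
  induction k with
  | zero => simp [gradDescent]
  | succ k ih =>
    set Z := gradDescent f η x k
    have h1 : gradDescent f η x (k + 1) - x = (Z - x) - η • (∇ f Z - ∇ f x) - η • ∇ f x := by
      rw [gradDescent_succ]; module
    have h2 : ‖gradDescent f η x (k + 1) - x‖ ≤ (1 + η * β) * ‖Z - x‖ + η * ‖∇ f x‖ := by
      rw [h1]
      refine (norm_sub_le _ _).trans ?_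
      rw [norm_smul, Real.norm_of_nonneg hη]
      gcongr
      refine (norm_sub_le _ _).trans ?_
      rw [norm_smul, Real.norm_of_nonneg hη]
      nlinarith [mul_le_mul_of_nonneg_left (hf.2 Z x) hη]
    have h3 : 1 ≤ (1 + η * β) ^ (k + 1) := one_le_pow₀ hρ
    have h4 : 0 ≤ η * ‖∇ f x‖ := by positivity
    calc ‖gradDescent f η x (k + 1) - x‖ ≤ (1 + η * β) * ‖Z - x‖ + η * ‖∇ f x‖ := h2
      _ ≤ (1 + η * β) * ((1 + η * β) ^ k * (k * (η * ‖∇ f x‖)))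
          + (1 + η * β) ^ (k + 1) * (η * ‖∇ f x‖) := by
          refine add_le_add (mul_le_mul_of_nonneg_left ih (by linarith)) ?_
          exact le_mul_of_one_le_left h4 h3
      _ = _ := by push_cast; ring

theorem one_add_pow_le {t : ℝ} (ht : 0 ≤ t) {k K : ℕ} (hk : k ≤ K) (hK : K * t ≤ 1 / 16) :
    ((1 + t) ^ k) ^ 2 ≤ 8 / 7 := by
  have h1 : (1 + t) ^ k ≤ Real.exp (1 / 16) := by
    calc (1 + t) ^ k ≤ (1 + t) ^ K := pow_le_pow_right₀ (by linarith) hk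
      _ ≤ Real.exp t ^ K := by gcongr; linarith [Real.add_one_le_exp t]
      _ = Real.exp (K * t) := by rw [← Real.exp_nat_mul]
      _ ≤ _ := Real.exp_le_exp.2 hK
  have h2 : Real.exp (1 / 16) ^ 2 ≤ 8 / 7 := by
    rw [← Real.exp_nat_mul]
    have h3 := Real.add_one_le_exp (-(1 / 8 : ℝ))
    have h4 : Real.exp (-(1 / 8 : ℝ)) * Real.exp (1 / 8) = 1 := by
      rw [← Real.exp_add]; simp
    have h5 : ((2 : ℕ) : ℝ) * (1 / 16) = 1 / 8 := by norm_num
    rw [h5]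
    nlinarith [Real.exp_pos (1 / 8 : ℝ)]
  exact (pow_le_pow_left₀ (by positivity) h1 2).trans h2

theorem norm_mean_sq_le {ι : Type*} (s : Finset ι) (a : ι → Vec d) :
    ‖(1 / (s.card : ℝ)) • ∑ p ∈ s, a p‖ ^ 2 ≤ 1 / (s.card : ℝ) * ∑ p ∈ s, ‖a p‖ ^ 2 := by
  rcases s.eq_empty_or_nonempty with rfl | hs
  · simp
  have hc : (0 : ℝ) < s.card := by exact_mod_cast hs.card_pos
  rw [norm_smul, Real.norm_of_nonneg (by positivity), mul_pow]
  have h1 : ‖∑ p ∈ s, a p‖ ^ 2 ≤ s.card * ∑ p ∈ s, ‖a p‖ ^ 2 :=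
    (pow_le_pow_left₀ (norm_nonneg _) (norm_sum_le s a) 2).trans sq_sum_le_card_mul_sum_sq
  calc (1 / (s.card : ℝ)) ^ 2 * ‖∑ p ∈ s, a p‖ ^ 2
      ≤ (1 / (s.card : ℝ)) ^ 2 * (s.card * ∑ p ∈ s, ‖a p‖ ^ 2) := by gcongr
    _ = _ := by field_simp

theorem norm_add_sq_le_two (a b : Vec d) : ‖a + b‖ ^ 2 ≤ 2 * ‖a‖ ^ 2 + 2 * ‖b‖ ^ 2 := by
  have := norm_add_le a b
  nlinarith [norm_nonneg (a + b), sq_nonneg (‖a‖ - ‖b‖)]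

theorem norm_sub_sq_le_triangle (a b c : Vec d) :
    ‖a - c‖ ^ 2 ≤ 17 * ‖a - b‖ ^ 2 + 17 / 16 * ‖b - c‖ ^ 2 := by
  have := norm_sub_le_norm_sub_add_norm_sub a b c
  nlinarith [norm_nonneg (a - c), sq_nonneg (16 * ‖a - b‖ - ‖b - c‖)]

variable {N : ℕ}

/-- The steps of one round: pairs of a user and the index of a local step. -/
def localSteps (N K : ℕ) : Finset (Fin N × ℕ) := Finset.univ ×ˢ Finset.range K

theorem card_localSteps (N K : ℕ) : ((localSteps N K).card : ℝ) = N * K := by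
  simp [localSteps]

theorem mean_localSteps {N K : ℕ} (hK : 0 < K) (a : Fin N → ℝ) :
    1 / ((localSteps N K).card : ℝ) * ∑ p ∈ localSteps N K, a p.1 = 1 / (N : ℝ) * ∑ i, a i := by
  have : (0 : ℝ) < K := by exact_mod_cast hK
  rw [card_localSteps, localSteps, Finset.sum_product]
  simp only [Finset.sum_const, Finset.card_range, nsmul_eq_mul]
  rw [← Finset.mul_sum]
  rcases N.eq_zero_or_pos with rfl | hN
  · simp
  have : (0 : ℝ) < N := by exact_mod_cast hN
  field_simp

theorem mean_smul_localSteps {N K : ℕ} (hK : 0 < K) (a : Fin N → Vec d) :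
    (1 / ((localSteps N K).card : ℝ)) • ∑ p ∈ localSteps N K, a p.1
      = (1 / (N : ℝ)) • ∑ i, a i := by
  have : (0 : ℝ) < K := by exact_mod_cast hK
  rw [card_localSteps, localSteps, Finset.sum_product]
  simp only [Finset.sum_const, Finset.card_range]
  rw [← Finset.smul_sum, ← Nat.cast_smul_eq_nsmul ℝ, smul_smul]
  congr 1
  rcases N.eq_zero_or_pos with rfl | hN
  · simp
  have : (0 : ℝ) < N := by exact_mod_cast hN
  field_simp

/-- The average of the gradients at the local iterates is an approximate subgradient of the global
loss at the starting point. -/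
theorem inner_mean_gradient_ge {f : Fin N → Vec d → ℝ} {β μ : ℝ} (hf : ∀ i, IsSmooth β (f i))
    (hc : ∀ i, StrongConvexOn Set.univ μ (f i)) (hμ : 0 ≤ μ) (hN : 0 < N) {K : ℕ} (hK : 0 < K)
    (Y : Fin N × ℕ → Vec d) (x z : Vec d) :
    globalLoss f x - globalLoss f z + μ / 4 * ‖x - z‖ ^ 2
      - (β + μ) / 2 * (1 / ((localSteps N K).card : ℝ) * ∑ p ∈ localSteps N K, ‖Y p - x‖ ^ 2)
      ≤ inner ℝ ((1 / ((localSteps N K).card : ℝ)) • ∑ p ∈ localSteps N K, ∇ (f p.1) (Y p))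
          (x - z) := by
  set n : ℝ := ((localSteps N K).card : ℝ) with hn
  have hn0 : 0 < n := by
    rw [hn, card_localSteps]
    exact mul_pos (by exact_mod_cast hN) (by exact_mod_cast hK)
  have h1 := Finset.sum_le_sum fun p (_ : p ∈ localSteps N K) =>
    perturbed_strong_convexity (hc p.1) (hf p.1) hμ x (Y p) z
  have h2 := mul_le_mul_of_nonneg_left h1 (by positivity : 0 ≤ 1 / n)
  rw [inner_smul_left, sum_inner]
  refine le_trans (le_of_eq ?_) h2
  have hx := mean_localSteps hK (fun i => f i x)
  have hz := mean_localSteps hK (fun i => f i z)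
  rw [globalLoss, globalLoss, ← hx, ← hz, ← hn]
  simp only [Finset.sum_sub_distrib, Finset.sum_add_distrib, Finset.sum_const, nsmul_eq_mul,
    ← Finset.mul_sum, ← hn]
  field_simp

theorem norm_mean_gradient_sq_le {f : Fin N → Vec d → ℝ} {β : ℝ}
    (hf : ∀ i, IsSmooth β (f i)) {K : ℕ} (hK : 0 < K) (Y : Fin N × ℕ → Vec d) (x : Vec d) :
    ‖(1 / ((localSteps N K).card : ℝ)) • ∑ p ∈ localSteps N K, ∇ (f p.1) (Y p)‖ ^ 2
      ≤ 2 * ‖∇ (globalLoss f) x‖ ^ 2 + 2 * β ^ 2 *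
        (1 / ((localSteps N K).card : ℝ) * ∑ p ∈ localSteps N K, ‖Y p - x‖ ^ 2) := by
  have h1 : (1 / ((localSteps N K).card : ℝ)) • ∑ p ∈ localSteps N K, ∇ (f p.1) (Y p)
      = ∇ (globalLoss f) x + (1 / ((localSteps N K).card : ℝ)) •
        ∑ p ∈ localSteps N K, (∇ (f p.1) (Y p) - ∇ (f p.1) x) := by
    rw [gradient_globalLoss (fun i => (hf i).1), ← mean_smul_localSteps hK, ← smul_add,
      ← Finset.sum_add_distrib]
    simp
  rw [h1]
  refine (norm_add_sq_le_two _ _).trans ?_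
  have h2 := norm_mean_sq_le (localSteps N K) fun p => ∇ (f p.1) (Y p) - ∇ (f p.1) x
  have h3 : ∑ p ∈ localSteps N K, ‖∇ (f p.1) (Y p) - ∇ (f p.1) x‖ ^ 2
      ≤ β ^ 2 * ∑ p ∈ localSteps N K, ‖Y p - x‖ ^ 2 := by
    rw [Finset.mul_sum]
    refine Finset.sum_le_sum fun p _ => ?_
    rw [← mul_pow]
    exact pow_le_pow_left₀ (norm_nonneg _) ((hf p.1).2 _ _) 2
  have h4 := mul_le_mul_of_nonneg_left h3
    (by positivity : 0 ≤ 1 / ((localSteps N K).card : ℝ))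
  linarith

theorem sum_range_cast_le (K : ℕ) : ∑ k ∈ Finset.range K, (k : ℝ) ≤ (K : ℝ) ^ 2 / 2 := by
  induction K with
  | zero => simp
  | succ K ih => rw [Finset.sum_range_succ]; push_cast; nlinarith

theorem sum_range_cast_sq_le (K : ℕ) : ∑ k ∈ Finset.range K, (k : ℝ) ^ 2 ≤ (K : ℝ) ^ 3 / 3 := by
  induction K with
  | zero => simp
  | succ K ih =>
    rw [Finset.sum_range_succ]; push_cast
    have : (0 : ℝ) ≤ K := K.cast_nonneg
    nlinarith

/-- The squared distance travelled by exact local gradient descent, averaged over users and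
steps. -/
theorem mean_norm_gradDescent_sub_sq_le {f : Fin N → Vec d → ℝ} {β η : ℝ} (hβ : 0 ≤ β)
    (hη : 0 ≤ η) (hf : ∀ i, IsSmooth β (f i)) {K : ℕ} (hK : 0 < K)
    (hstep : K * (η * β) ≤ 1 / 16) (x : Vec d) :
    1 / ((localSteps N K).card : ℝ) *
        ∑ p ∈ localSteps N K, ‖gradDescent (f p.1) η x p.2 - x‖ ^ 2
      ≤ 8 / 21 * (K * η) ^ 2 * (1 / (N : ℝ) * ∑ i, ‖∇ (f i) x‖ ^ 2) := by
  have hK' : (0 : ℝ) < K := by exact_mod_cast hK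
  have h1 : ∀ p ∈ localSteps N K, ‖gradDescent (f p.1) η x p.2 - x‖ ^ 2
      ≤ 8 / 7 * ((p.2 : ℝ) ^ 2 * (η ^ 2 * ‖∇ (f p.1) x‖ ^ 2)) := by
    intro p hp
    have hk : p.2 ≤ K := by
      simp only [localSteps, Finset.mem_product, Finset.mem_range] at hp; omega
    have h2 := pow_le_pow_left₀ (norm_nonneg _)
      ((hf p.1).norm_gradDescent_sub_le hβ hη x p.2) 2
    have h3 := one_add_pow_le (mul_nonneg hη hβ) hk hstep
    refine h2.trans ?_
    rw [mul_pow, mul_pow, mul_pow]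
    gcongr
  have h2 : ∑ p ∈ localSteps N K, ‖gradDescent (f p.1) η x p.2 - x‖ ^ 2
      ≤ 8 / 7 * ((K : ℝ) ^ 3 / 3) * η ^ 2 * ∑ i, ‖∇ (f i) x‖ ^ 2 := by
    refine (Finset.sum_le_sum h1).trans ?_
    rw [localSteps, Finset.sum_product, Finset.mul_sum]
    refine Finset.sum_le_sum fun i _ => ?_
    simp only
    rw [← Finset.mul_sum, ← Finset.sum_mul]
    have := mul_le_mul_of_nonneg_right (sum_range_cast_sq_le K)
      (by positivity : 0 ≤ η ^ 2 * ‖∇ (f i) x‖ ^ 2)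
    linarith
  refine (mul_le_mul_of_nonneg_left h2 (by positivity)).trans (le_of_eq ?_)
  rw [card_localSteps]
  rcases N.eq_zero_or_pos with rfl | hN
  · simp
  have : (0 : ℝ) < N := by exact_mod_cast hN
  field_simp
  ring

end Deterministic

/-! ### One round of federated averaging -/

section Round

variable {Ω Ξ : Type*} {N d : ℕ}

/-- The information in `H` together with all samples `s j l` other than `s i k`. -/
@[reducible]
def otherInfo [MeasurableSpace Ξ] (H : MeasurableSpace Ω) (s : Fin N → ℕ → Ω → Ξ) (i : Fin N)
    (k : ℕ) : MeasurableSpace Ω :=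
  H ⊔ ⨆ p : Fin N × ℕ, ⨆ _ : p ≠ (i, k), MeasurableSpace.comap (s p.1 p.2) inferInstance

theorem measurable_otherInfo [MeasurableSpace Ξ] (H : MeasurableSpace Ω)
    (s : Fin N → ℕ → Ω → Ξ) {i j : Fin N} {k l : ℕ} (h : (i, k) ≠ (j, l)) :
    Measurable[otherInfo H s j l] (s i k) := by
  rw [measurable_iff_comap_le]
  exact le_sup_of_le_right (le_iSup₂_of_le (i, k) h le_rfl)

/-- A square-integrable starting point `x` of a round, known from the past `H`, and fresh samples
`s i k` for the local steps: each sample is independent of the past and of all other samples. -/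
structure FreshSamples [MeasurableSpace Ξ] (H : MeasurableSpace Ω) [mΩ : MeasurableSpace Ω]
    (Pr : Measure Ω) (ν : Fin N → Measure Ξ) (x : Ω → Vec d) (s : Fin N → ℕ → Ω → Ξ) :
    Prop where
  le : H ≤ mΩ
  measurable_start : Measurable[H] x
  memLp_start : MemLp x 2 Pr
  measurable : ∀ i k, Measurable (s i k)
  law : ∀ i k, Pr.map (s i k) = ν i
  indep : ∀ i k, Indep (MeasurableSpace.comap (s i k) inferInstance) (otherInfo H s i k) Pr

theorem measurable_sgd [MeasurableSpace Ξ] {H : MeasurableSpace Ω} {g : Vec d → Ξ → Vec d}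
    (hg : Measurable (Function.uncurry g)) {η : ℝ} {x : Ω → Vec d} {s : ℕ → Ω → Ξ} {k : ℕ}
    (hx : Measurable[H] x) (hs : ∀ l < k, Measurable[H] (s l)) :
    Measurable[H] fun ω => sgd g η (fun l => s l ω) (x ω) k := by
  induction k with
  | zero => exact hx
  | succ k ih =>
    have h1 := ih fun l hl => hs l (hl.trans (Nat.lt_succ_self k))
    exact h1.sub ((hg.comp (h1.prodMk (hs k (Nat.lt_succ_self k)))).const_smul η)

theorem measurable_gradDescent {H : MeasurableSpace Ω} {f : Vec d → ℝ}
    (hf : Continuous (∇ f)) {η : ℝ} {x : Ω → Vec d} (hx : Measurable[H] x) (k : ℕ) :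
    Measurable[H] fun ω => gradDescent f η (x ω) k := by
  induction k with
  | zero => exact hx
  | succ k ih =>
    simp only [gradDescent_succ]
    exact ih.sub ((hf.measurable.comp ih).const_smul η)

theorem mean_local_sub_eq {f : Fin N → Vec d → ℝ} {g : Fin N → Vec d → Ξ → Vec d} {η : ℝ}
    (hN : 0 < N) {K : ℕ} (hK : 0 < K) (x z : Vec d)
    (s : Fin N → ℕ → Ξ) :
    (1 / (N : ℝ)) • ∑ i, sgd (g i) η (s i) x K - z
      = (x - z) - (K * η) • (
        (1 / ((localSteps N K).card : ℝ)) •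
          ∑ p ∈ localSteps N K, ∇ (f p.1) (sgd (g p.1) η (s p.1) x p.2)
        + (1 / ((localSteps N K).card : ℝ)) •
          ∑ p ∈ localSteps N K, (g p.1 (sgd (g p.1) η (s p.1) x p.2) (s p.1 p.2)
            - ∇ (f p.1) (sgd (g p.1) η (s p.1) x p.2))) := by
  have hK' : (K : ℝ) ≠ 0 := by exact_mod_cast hK.ne'
  have hN' : (N : ℝ) ≠ 0 := by exact_mod_cast hN.ne'
  rw [← smul_add, ← Finset.sum_add_distrib]
  simp only [add_sub_cancel]
  have h1 : ∀ i, sgd (g i) η (s i) x K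
      = x - η • ∑ l ∈ Finset.range K, g i (sgd (g i) η (s i) x l) (s i l) :=
    fun i => sgd_eq_sub_sum _ _ _ _ _
  simp_rw [h1]
  rw [Finset.sum_sub_distrib, smul_sub, ← Finset.smul_sum, localSteps, Finset.sum_product,
    ← localSteps, card_localSteps, smul_smul, smul_smul]
  have h2 : (1 / (N : ℝ)) • ∑ _i : Fin N, x = x := by
    rw [Finset.sum_const, Finset.card_univ, Fintype.card_fin, ← Nat.cast_smul_eq_nsmul ℝ,
      smul_smul, one_div_mul_cancel hN', one_smul]
  have h3 : (K : ℝ) * η * (1 / (N * K)) = 1 / N * η := by field_simp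
  rw [h2, h3]
  abel

/-- One round, before taking expectations: the squared distance to `z` after the round, with the
averaged squared drift of the local iterates and the averaged gradient error as error terms. -/
theorem norm_mean_local_sub_sq_le {f : Fin N → Vec d → ℝ} {g : Fin N → Vec d → Ξ → Vec d}
    {β μ η : ℝ} (hN : 0 < N) (hf : ∀ i, IsSmooth β (f i))
    (hc : ∀ i, StrongConvexOn Set.univ μ (f i)) (hβ : 0 < β) (hμ : 0 < μ) (hμβ : μ ≤ β)
    (hη : 0 < η) {K : ℕ} (hK : 0 < K) (hβh : K * η * β ≤ 1 / 16)
    {z : Vec d} (hz : ∀ y, globalLoss f z ≤ globalLoss f y) (x : Vec d) (s : Fin N → ℕ → Ξ)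
    {Y : Fin N × ℕ → Vec d} (hY : ∀ p, Y p = sgd (g p.1) η (s p.1) x p.2) {ζ : Vec d}
    (hζ : ζ = (1 / ((localSteps N K).card : ℝ)) • ∑ p ∈ localSteps N K,
      (g p.1 (Y p) (s p.1 p.2) - ∇ (f p.1) (Y p))) {D : ℝ}
    (hD : D = 1 / ((localSteps N K).card : ℝ) * ∑ p ∈ localSteps N K, ‖Y p - x‖ ^ 2) :
    ‖(1 / (N : ℝ)) • ∑ i, sgd (g i) η (s i) x K - z‖ ^ 2
      ≤ (1 - μ * (K * η) / 2) * ‖x - z‖ ^ 2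
        + (-(3 / 2) * (K * η)) * (globalLoss f x - globalLoss f z)
        + (9 / 4 * (K * η * β)) * D + (2 * (K * η) ^ 2) * ‖ζ‖ ^ 2
        + (-2 * (K * η)) * inner ℝ ζ (x - z) := by
  have hK' : (0 : ℝ) < K := by exact_mod_cast hK
  have hFs : IsSmooth β (globalLoss f) := IsSmooth.globalLoss hN hf
  set h : ℝ := K * η with hh
  have hh0 : 0 < h := by positivity
  set V : Vec d := (1 / ((localSteps N K).card : ℝ)) •
    ∑ p ∈ localSteps N K, ∇ (f p.1) (Y p) with hV
  set Δ : ℝ := globalLoss f x - globalLoss f z with hΔ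
  have e1 : (1 / (N : ℝ)) • ∑ i, sgd (g i) η (s i) x K - z = (x - z) - h • (V + ζ) := by
    rw [hV, hζ]
    simp_rw [hY]
    exact mean_local_sub_eq hN hK x z s
  have e2 : (inner ℝ V (x - z) : ℝ) ≥ Δ + μ / 4 * ‖x - z‖ ^ 2
      - (β + μ) / 2 * D :=
    hD ▸ inner_mean_gradient_ge hf hc hμ.le hN hK Y x z
  have e3 : ‖V‖ ^ 2 ≤ 2 * ‖∇ (globalLoss f) x‖ ^ 2 + 2 * β ^ 2 * D :=
    hD ▸ norm_mean_gradient_sq_le hf hK Y x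
  have e4 : ‖∇ (globalLoss f) x‖ ^ 2 ≤ 2 * β * Δ := hFs.norm_gradient_sq_le hβ hz x
  have e5 := norm_add_sq_le_two V ζ
  have hD0 : 0 ≤ D := by rw [hD]; positivity
  have hΔ0 : 0 ≤ Δ := sub_nonneg.2 (hz _)
  rw [e1, norm_sub_sq_real, inner_smul_right, norm_smul, mul_pow, Real.norm_of_nonneg hh0.le,
    inner_add_right, real_inner_comm V, real_inner_comm ζ]
  have f1 : h ^ 2 * ‖V + ζ‖ ^ 2 ≤ h ^ 2 * (2 * (4 * β * Δ + 2 * β ^ 2 * D)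
      + 2 * ‖ζ‖ ^ 2) := by
    gcongr; linarith
  have f2 := mul_le_mul_of_nonneg_left e2 (by positivity : 0 ≤ 2 * h)
  have f3 : h ^ 2 * (8 * β * Δ) ≤ h * (1 / 2 * Δ) := by
    have := mul_le_mul_of_nonneg_right hβh (by positivity : 0 ≤ 8 * (h * Δ))
    linarith
  have f4 : h ^ 2 * (4 * β ^ 2 * D) ≤ 1 / 4 * (h * β) * D := by
    have := mul_le_mul_of_nonneg_right hβh (by positivity : 0 ≤ 4 * ((h * β) * D))
    linarith
  have f5 : h * ((β + μ) * D) ≤ 2 * (h * β) * D := by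
    have := mul_le_mul_of_nonneg_right hμβ (by positivity : 0 ≤ h * D)
    linarith
  linarith

/-- The arithmetic of one round: `X` and `X'` are the mean squared distances before and after the
round, `Δ` is the mean suboptimality gap, `D` the mean drift and `Z` the mean squared gradient
error. The numerical constants come from `h β ≤ 1 / 16` and `(h β)² B² ≤ 1 / 256`. -/
theorem round_arithmetic {X X' Δ D Z h β σ G B q N K : ℝ} (hN : 1 ≤ N) (hK : 0 < K)
    (hh0 : 0 < h) (hβ : 0 < β) (hB : 1 ≤ B) (hstep : h * β * (8 * (1 + B ^ 2)) ≤ 1)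
    (hΔ0 : 0 ≤ Δ)
    (hX' : X' ≤ q * X + (-(3 / 2) * h) * Δ + (9 / 4 * (h * β)) * D + (2 * h ^ 2) * Z)
    (hnoise : Z ≤ σ ^ 2 / (N * K))
    (hdrift : D ≤ 68 / 7 * h ^ 2 * (σ ^ 2 / K)
      + 17 / 42 * h ^ 2 * (G ^ 2 + B ^ 2 * (2 * β * Δ))) :
    X' ≤ q * X - 29 / 20 * h * Δ
      + (17 / 10 * (σ ^ 2 * (1 + N) / (K * N)) * h ^ 2 + 23 / 25 * (β * G ^ 2) * h ^ 3) := by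
  have hβh0 : 0 < h * β := by positivity
  have hN0 : 0 < N := by linarith
  have hβh : h * β ≤ 1 / 16 := by nlinarith
  have g1 := mul_le_mul_of_nonneg_left hnoise (by positivity : 0 ≤ 2 * h ^ 2)
  have g2 := mul_le_mul_of_nonneg_left hdrift (by positivity : 0 ≤ 9 / 4 * (h * β))
  have hs1 : σ ^ 2 * (1 + N) / (K * N) = σ ^ 2 / (N * K) + σ ^ 2 / K := by
    field_simp
  have hs2 : σ ^ 2 / (N * K) ≤ σ ^ 2 / K := by
    gcongr
    nlinarith
  have hs3 : 0 ≤ σ ^ 2 / K := by positivity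
  have g3 : h * β * (h ^ 2 * (σ ^ 2 / K)) ≤ 1 / 16 * (h ^ 2 * (σ ^ 2 / K)) := by gcongr
  have g4 : h ^ 2 * (σ ^ 2 / (N * K)) ≤ h ^ 2 * (σ ^ 2 / K) := by gcongr
  have g5 : 0 ≤ h ^ 2 * (σ ^ 2 / K) := by positivity
  have g6 : 0 ≤ h ^ 2 * (σ ^ 2 / (N * K)) := by positivity
  have hB2 : (h * β) ^ 2 * B ^ 2 ≤ 1 / 256 := by
    have e1 : h * β * (1 + B ^ 2) ≤ 1 / 8 := by linarith
    have e2 : (h * β * (1 + B ^ 2)) ^ 2 ≤ (1 / 8) ^ 2 :=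
      pow_le_pow_left₀ (by positivity) e1 2
    nlinarith [mul_nonneg (sq_nonneg (h * β)) (sq_nonneg (1 - B ^ 2))]
  have g7 : (h * β) ^ 2 * B ^ 2 * (h * Δ) ≤ 1 / 256 * (h * Δ) := by
    gcongr
  have g8 : 0 ≤ h * Δ := by positivity
  have g9 : 0 ≤ β * G ^ 2 * h ^ 3 := by positivity
  rw [hs1]
  linarith

namespace FreshSamples

variable [MeasurableSpace Ξ] {H : MeasurableSpace Ω} [mΩ : MeasurableSpace Ω] {Pr : Measure Ω}
  {ν : Fin N → Measure Ξ} {x : Ω → Vec d} {s : Fin N → ℕ → Ω → Ξ}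
  {f : Fin N → Vec d → ℝ} {g : Fin N → Vec d → Ξ → Vec d} {β μ σ η : ℝ}

theorem otherInfo_le (hF : FreshSamples H Pr ν x s) (i : Fin N) (k : ℕ) :
    otherInfo H s i k ≤ mΩ :=
  sup_le hF.le (iSup₂_le fun p _ => (hF.measurable p.1 p.2).comap_le)

theorem measurable_start_otherInfo (hF : FreshSamples H Pr ν x s) (i : Fin N) (k : ℕ) :
    Measurable[otherInfo H s i k] x :=
  hF.measurable_start.mono le_sup_left le_rfl

theorem measurable_local (hF : FreshSamples H Pr ν x s)
    (hg : ∀ i, IsStochasticGradient (ν i) (f i) (g i) σ) {i j : Fin N} {k l : ℕ}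
    (h : i = j → k ≤ l) :
    Measurable[otherInfo H s j l] fun ω => sgd (g i) η (fun l => s i l ω) (x ω) k := by
  refine measurable_sgd (hg i).measurable (hF.measurable_start_otherInfo j l)
    fun l' hl' => measurable_otherInfo H s fun he => ?_
  rw [Prod.mk.injEq] at he
  have := h he.1
  omega

variable [IsProbabilityMeasure Pr]

theorem error_moments (hF : FreshSamples H Pr ν x s) (hf : ∀ i, IsSmooth β (f i))
    (hg : ∀ i, IsStochasticGradient (ν i) (f i) (g i) σ) (i : Fin N) (k : ℕ) :
    MemLp (fun ω => g i (sgd (g i) η (fun l => s i l ω) (x ω) k) (s i k ω)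
      - ∇ (f i) (sgd (g i) η (fun l => s i l ω) (x ω) k)) 2 Pr ∧
    ∫ ω, ‖g i (sgd (g i) η (fun l => s i l ω) (x ω) k) (s i k ω)
      - ∇ (f i) (sgd (g i) η (fun l => s i l ω) (x ω) k)‖ ^ 2 ∂Pr ≤ σ ^ 2 ∧
    ∀ Z : Ω → Vec d, Measurable[otherInfo H s i k] Z → MemLp Z 2 Pr →
      ∫ ω, inner ℝ (g i (sgd (g i) η (fun l => s i l ω) (x ω) k) (s i k ω)
        - ∇ (f i) (sgd (g i) η (fun l => s i l ω) (x ω) k)) (Z ω) ∂Pr = 0 :=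
  (hg i).error_moments (hF.otherInfo_le i k) (hf i).continuous_gradient (hF.measurable i k)
    (hF.law i k) (hF.indep i k) (hF.measurable_local hg fun _ => le_rfl)

theorem memLp_local (hF : FreshSamples H Pr ν x s) (hf : ∀ i, IsSmooth β (f i))
    (hg : ∀ i, IsStochasticGradient (ν i) (f i) (g i) σ) (i : Fin N) (k : ℕ) :
    MemLp (fun ω => sgd (g i) η (fun l => s i l ω) (x ω) k) 2 Pr := by
  induction k with
  | zero => exact hF.memLp_start
  | succ k ih =>
    have h1 := (hF.error_moments (η := η) hf hg i k).1
    have h2 := memLp_two_of_lipschitz (hf i).2 ih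
    refine (ih.sub ((h1.add h2).const_smul η)).ae_eq (Filter.Eventually.of_forall fun ω => ?_)
    simp [sgd, smul_sub]

theorem memLp_gradDescent (hF : FreshSamples H Pr ν x s) (hf : ∀ i, IsSmooth β (f i))
    (i : Fin N) (k : ℕ) : MemLp (fun ω => gradDescent (f i) η (x ω) k) 2 Pr := by
  induction k with
  | zero => exact hF.memLp_start
  | succ k ih =>
    simp only [gradDescent_succ]
    exact ih.sub ((memLp_two_of_lipschitz (hf i).2 ih).const_smul η)

/-- The mean squared deviation of stochastic from exact local gradient descent grows only linearly
in the number of steps, because the gradient errors are orthogonal to the past. -/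
theorem integral_norm_local_sub_gradDescent_sq_le (hF : FreshSamples H Pr ν x s)
    (hf : ∀ i, IsSmooth β (f i)) (hg : ∀ i, IsStochasticGradient (ν i) (f i) (g i) σ)
    (hβ : 0 ≤ β) (hη : 0 ≤ η) (i : Fin N) (k : ℕ) :
    ∫ ω, ‖sgd (g i) η (fun l => s i l ω) (x ω) k - gradDescent (f i) η (x ω) k‖ ^ 2 ∂Pr
      ≤ ((1 + η * β) ^ k) ^ 2 * (k * (η ^ 2 * σ ^ 2)) := by
  induction k with
  | zero => simp [sgd, gradDescent]
  | succ k ih =>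
    set Y : Ω → Vec d := fun ω => sgd (g i) η (fun l => s i l ω) (x ω) k with hY
    set Z : Ω → Vec d := fun ω => gradDescent (f i) η (x ω) k with hZ
    have hY2 : MemLp Y 2 Pr := hF.memLp_local hf hg i k
    have hZ2 : MemLp Z 2 Pr := hF.memLp_gradDescent hf i k
    have hYm : Measurable[otherInfo H s i k] Y := hF.measurable_local hg fun _ => le_rfl
    have hZm : Measurable[otherInfo H s i k] Z :=
      measurable_gradDescent (hf i).continuous_gradient (hF.measurable_start_otherInfo i k) k
    have hcont := (hf i).continuous_gradient.measurable
    obtain ⟨hζ2, hζσ, hζ0⟩ := hF.error_moments (η := η) hf hg i k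
    set ζ : Ω → Vec d := fun ω => g i (Y ω) (s i k ω) - ∇ (f i) (Y ω) with hζ
    set A : Ω → Vec d := fun ω => (Y ω - Z ω) - η • (∇ (f i) (Y ω) - ∇ (f i) (Z ω)) with hA
    have hA2 : MemLp A 2 Pr := (hY2.sub hZ2).sub
      (((memLp_two_of_lipschitz (hf i).2 hY2).sub
        (memLp_two_of_lipschitz (hf i).2 hZ2)).const_smul η)
    have hAm : Measurable[otherInfo H s i k] A := (hYm.sub hZm).sub
      (((hcont.comp hYm).sub (hcont.comp hZm)).const_smul η)
    have hdec : ∀ ω, sgd (g i) η (fun l => s i l ω) (x ω) (k + 1)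
        - gradDescent (f i) η (x ω) (k + 1) = A ω + ((-η) • ζ) ω := by
      intro ω
      rw [gradDescent_succ, sgd]
      simp only [hA, hζ, hY, hZ, Pi.smul_apply]
      module
    simp_rw [hdec]
    rw [integral_norm_add_sq hA2 (hζ2.const_smul (-η))]
    have h1 : ∫ ω, inner ℝ (A ω) (((-η) • ζ) ω) ∂Pr = 0 := by
      have : ∀ ω, (inner ℝ (A ω) (((-η) • ζ) ω) : ℝ) = -η * inner ℝ (ζ ω) (A ω) := fun ω => by
        rw [Pi.smul_apply, inner_smul_right, real_inner_comm]
      simp_rw [this]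
      rw [integral_const_mul, hζ0 A hAm hA2, mul_zero]
    have h2 : ∫ ω, ‖((-η) • ζ) ω‖ ^ 2 ∂Pr ≤ η ^ 2 * σ ^ 2 := by
      have : ∀ ω, ‖((-η) • ζ) ω‖ ^ 2 = η ^ 2 * ‖ζ ω‖ ^ 2 := fun ω => by
        rw [Pi.smul_apply, norm_smul, mul_pow, Real.norm_eq_abs, sq_abs, neg_sq]
      simp_rw [this]
      rw [integral_const_mul]
      gcongr
    have h3 : ∫ ω, ‖A ω‖ ^ 2 ∂Pr ≤ (1 + η * β) ^ 2 * ∫ ω, ‖Y ω - Z ω‖ ^ 2 ∂Pr := by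
      rw [← integral_const_mul]
      refine integral_mono (integrable_norm_sq_of_memLp_two hA2)
        ((integrable_norm_sq_of_memLp_two (hY2.sub hZ2)).const_mul _) fun ω => ?_
      simp only [← mul_pow]
      refine pow_le_pow_left₀ (norm_nonneg _) ((norm_sub_le _ _).trans ?_) 2
      rw [norm_smul, Real.norm_of_nonneg hη]
      nlinarith [mul_le_mul_of_nonneg_left ((hf i).2 (Y ω) (Z ω)) hη]
    have h4 : 1 ≤ ((1 + η * β) ^ (k + 1)) ^ 2 :=
      one_le_pow₀ (one_le_pow₀ (by nlinarith [mul_nonneg hη hβ]))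
    have h5 : (1 + η * β) ^ 2 * ∫ ω, ‖Y ω - Z ω‖ ^ 2 ∂Pr
        ≤ (1 + η * β) ^ 2 * (((1 + η * β) ^ k) ^ 2 * (k * (η ^ 2 * σ ^ 2))) :=
      mul_le_mul_of_nonneg_left ih (by positivity)
    have h6 : η ^ 2 * σ ^ 2 ≤ ((1 + η * β) ^ (k + 1)) ^ 2 * (η ^ 2 * σ ^ 2) :=
      le_mul_of_one_le_left (by positivity) h4
    have h7 : ((1 + η * β) ^ (k + 1)) ^ 2 * (((k + 1 : ℕ) : ℝ) * (η ^ 2 * σ ^ 2))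
        = (1 + η * β) ^ 2 * (((1 + η * β) ^ k) ^ 2 * (k * (η ^ 2 * σ ^ 2)))
          + ((1 + η * β) ^ (k + 1)) ^ 2 * (η ^ 2 * σ ^ 2) := by
      push_cast; ring
    rw [h1, h7]
    linarith

/-- The averaged gradient errors of a round: the `N K` errors are pairwise orthogonal in `L²`. -/
theorem integral_norm_mean_error_sq_le (hF : FreshSamples H Pr ν x s)
    (hf : ∀ i, IsSmooth β (f i)) (hg : ∀ i, IsStochasticGradient (ν i) (f i) (g i) σ) (K : ℕ) :
    ∫ ω, ‖(1 / ((localSteps N K).card : ℝ)) • ∑ p ∈ localSteps N K,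
        (g p.1 (sgd (g p.1) η (fun l => s p.1 l ω) (x ω) p.2) (s p.1 p.2 ω)
          - ∇ (f p.1) (sgd (g p.1) η (fun l => s p.1 l ω) (x ω) p.2))‖ ^ 2 ∂Pr
      ≤ σ ^ 2 / (localSteps N K).card := by
  set ζ : Fin N × ℕ → Ω → Vec d := fun p ω =>
    g p.1 (sgd (g p.1) η (fun l => s p.1 l ω) (x ω) p.2) (s p.1 p.2 ω)
      - ∇ (f p.1) (sgd (g p.1) η (fun l => s p.1 l ω) (x ω) p.2) with hζ
  have hm : ∀ p q : Fin N × ℕ, p ≠ q → (p.1 = q.1 → p.2 ≤ q.2) →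
      Measurable[otherInfo H s q.1 q.2] (ζ p) := by
    intro p q hpq h
    have h1 := hF.measurable_local (η := η) hg h
    exact ((hg p.1).measurable.comp (h1.prodMk (measurable_otherInfo H s hpq))).sub
      ((hf p.1).continuous_gradient.measurable.comp h1)
  have horth : ∀ p q : Fin N × ℕ, p ≠ q → ∫ ω, inner ℝ (ζ p ω) (ζ q ω) ∂Pr = 0 := by
    intro p q hpq
    by_cases h : p.1 = q.1 → p.2 ≤ q.2
    · have := (hF.error_moments (η := η) hf hg q.1 q.2).2.2 _ (hm p q hpq h)
        (hF.error_moments hf hg p.1 p.2).1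
      simp_rw [fun ω => real_inner_comm (ζ q ω) (ζ p ω)]
      exact this
    · have h' : q.1 = p.1 → q.2 ≤ p.2 := by
        intro he
        by_contra hcon
        exact h fun _ => by omega
      exact (hF.error_moments (η := η) hf hg p.1 p.2).2.2 _ (hm q p hpq.symm h')
        (hF.error_moments hf hg q.1 q.2).1
  have h1 := integral_norm_sum_sq (Pr := Pr) (localSteps N K) (X := ζ)
    (fun p _ => (hF.error_moments hf hg p.1 p.2).1) (fun p _ q _ hpq => horth p q hpq)
  have h2 : ∀ ω, ‖(1 / ((localSteps N K).card : ℝ)) • ∑ p ∈ localSteps N K, ζ p ω‖ ^ 2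
      = (1 / ((localSteps N K).card : ℝ)) ^ 2 * ‖∑ p ∈ localSteps N K, ζ p ω‖ ^ 2 := fun ω => by
    rw [norm_smul, mul_pow, Real.norm_of_nonneg (by positivity)]
  change ∫ ω, ‖(1 / ((localSteps N K).card : ℝ)) • ∑ p ∈ localSteps N K, ζ p ω‖ ^ 2 ∂Pr ≤ _
  simp_rw [h2]
  rw [integral_const_mul, h1]
  have h3 : ∑ p ∈ localSteps N K, ∫ ω, ‖ζ p ω‖ ^ 2 ∂Pr ≤ (localSteps N K).card * σ ^ 2 := by
    refine (Finset.sum_le_sum fun p _ => (hF.error_moments hf hg p.1 p.2).2.1).trans ?_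
    simp
  refine (mul_le_mul_of_nonneg_left h3 (by positivity)).trans (le_of_eq ?_)
  rcases eq_or_ne ((localSteps N K).card : ℝ) 0 with h0 | h0
  · simp [h0]
  · field_simp

/-- The expected squared drift of the local iterates from the starting point, averaged over users
and steps. -/
theorem integral_mean_drift_le (hF : FreshSamples H Pr ν x s) (hN : 0 < N)
    (hf : ∀ i, IsSmooth β (f i)) (hg : ∀ i, IsStochasticGradient (ν i) (f i) (g i) σ)
    (hβ : 0 < β) (hη : 0 ≤ η) {K : ℕ} (hK : 0 < K) (hstep : K * (η * β) ≤ 1 / 16) {G B : ℝ}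
    (hdiss : BoundedDissimilarity f G B) {z : Vec d} (hz : ∀ y, globalLoss f z ≤ globalLoss f y) :
    ∫ ω, 1 / ((localSteps N K).card : ℝ) * ∑ p ∈ localSteps N K,
        ‖sgd (g p.1) η (fun l => s p.1 l ω) (x ω) p.2 - x ω‖ ^ 2 ∂Pr
      ≤ 68 / 7 * (K * η) ^ 2 * (σ ^ 2 / K) + 17 / 42 * (K * η) ^ 2 *
        (G ^ 2 + B ^ 2 * (2 * β * ∫ ω, (globalLoss f (x ω) - globalLoss f z) ∂Pr)) := by
  set c : ℝ := 1 / ((localSteps N K).card : ℝ) with hc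
  have hc0 : 0 ≤ c := by positivity
  have hK' : (0 : ℝ) < K := by exact_mod_cast hK
  have hN' : (0 : ℝ) < N := by exact_mod_cast hN
  have hFs : IsSmooth β (globalLoss f) := IsSmooth.globalLoss hN hf
  have hFint : Integrable (fun ω => globalLoss f (x ω) - globalLoss f z) Pr :=
    (hFs.integrable_comp hβ hz hF.memLp_start).sub (integrable_const _)
  have hYZ : ∀ p : Fin N × ℕ, Integrable (fun ω =>
      ‖sgd (g p.1) η (fun l => s p.1 l ω) (x ω) p.2 - gradDescent (f p.1) η (x ω) p.2‖ ^ 2) Pr :=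
    fun p => integrable_norm_sq_of_memLp_two
      ((hF.memLp_local hf hg p.1 p.2).sub (hF.memLp_gradDescent hf p.1 p.2))
  have hYx : ∀ p : Fin N × ℕ, Integrable (fun ω =>
      ‖sgd (g p.1) η (fun l => s p.1 l ω) (x ω) p.2 - x ω‖ ^ 2) Pr :=
    fun p => integrable_norm_sq_of_memLp_two ((hF.memLp_local hf hg p.1 p.2).sub hF.memLp_start)
  have hI1 : Integrable (fun ω => 17 * (c * ∑ p ∈ localSteps N K,
      ‖sgd (g p.1) η (fun l => s p.1 l ω) (x ω) p.2
        - gradDescent (f p.1) η (x ω) p.2‖ ^ 2)) Pr :=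
    ((integrable_finsetSum _ fun p _ => hYZ p).const_mul c).const_mul 17
  have hI2 : Integrable (fun ω => 17 / 42 * (K * η) ^ 2 *
      (G ^ 2 + B ^ 2 * (2 * β * (globalLoss f (x ω) - globalLoss f z)))) Pr :=
    ((integrable_const _).add ((hFint.const_mul _).const_mul _)).const_mul _
  have hpt : ∀ ω, c * ∑ p ∈ localSteps N K,
        ‖sgd (g p.1) η (fun l => s p.1 l ω) (x ω) p.2 - x ω‖ ^ 2
      ≤ 17 * (c * ∑ p ∈ localSteps N K, ‖sgd (g p.1) η (fun l => s p.1 l ω) (x ω) p.2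
          - gradDescent (f p.1) η (x ω) p.2‖ ^ 2)
        + 17 / 42 * (K * η) ^ 2 *
          (G ^ 2 + B ^ 2 * (2 * β * (globalLoss f (x ω) - globalLoss f z))) := by
    intro ω
    have h1 := mul_le_mul_of_nonneg_left (Finset.sum_le_sum fun p (_ : p ∈ localSteps N K) =>
      norm_sub_sq_le_triangle (sgd (g p.1) η (fun l => s p.1 l ω) (x ω) p.2)
        (gradDescent (f p.1) η (x ω) p.2) (x ω)) hc0
    rw [Finset.sum_add_distrib, ← Finset.mul_sum, ← Finset.mul_sum] at h1
    have h2 := mean_norm_gradDescent_sub_sq_le hβ.le hη hf hK hstep (x ω)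
    rw [← hc] at h2
    have h3 := (hdiss (x ω)).trans (add_le_add le_rfl (mul_le_mul_of_nonneg_left
      (hFs.norm_gradient_sq_le hβ hz (x ω)) (sq_nonneg B)))
    have h4 := mul_le_mul_of_nonneg_left h3 (by positivity : 0 ≤ 8 / 21 * (K * η) ^ 2)
    linarith
  have hmono := integral_mono ((integrable_finsetSum _ fun p _ => hYx p).const_mul c)
    (hI1.add hI2) hpt
  refine hmono.trans ?_
  rw [integral_add' hI1 hI2, integral_const_mul, integral_const_mul, integral_const_mul,
    integral_add (integrable_const _) ((hFint.const_mul _).const_mul _), integral_const_mul,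
    integral_const_mul, integral_finsetSum _ fun p _ => hYZ p]
  have h1 : ∑ p ∈ localSteps N K, ∫ ω, ‖sgd (g p.1) η (fun l => s p.1 l ω) (x ω) p.2
      - gradDescent (f p.1) η (x ω) p.2‖ ^ 2 ∂Pr
      ≤ N * (8 / 7 * (((K : ℝ) ^ 2 / 2) * (η ^ 2 * σ ^ 2))) := by
    have h2 : ∀ p ∈ localSteps N K, ∫ ω, ‖sgd (g p.1) η (fun l => s p.1 l ω) (x ω) p.2
        - gradDescent (f p.1) η (x ω) p.2‖ ^ 2 ∂Pr ≤ 8 / 7 * (p.2 * (η ^ 2 * σ ^ 2)) := by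
      intro p hp
      have hk : p.2 ≤ K := by
        simp only [localSteps, Finset.mem_product, Finset.mem_range] at hp; omega
      refine (hF.integral_norm_local_sub_gradDescent_sq_le hf hg hβ.le hη p.1 p.2).trans ?_
      have := one_add_pow_le (mul_nonneg hη hβ.le) hk hstep
      gcongr
    refine (Finset.sum_le_sum h2).trans ?_
    rw [localSteps, Finset.sum_product]
    simp only [← Finset.mul_sum, ← Finset.sum_mul, Finset.sum_const, Finset.card_univ,
      Fintype.card_fin, nsmul_eq_mul]
    have h3 := mul_le_mul_of_nonneg_right (sum_range_cast_le K)
      (by positivity : 0 ≤ N * (8 / 7 * (η ^ 2 * σ ^ 2)))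
    linarith
  have h2 := mul_le_mul_of_nonneg_left h1 hc0
  have h3 : c * (N * (8 / 7 * (((K : ℝ) ^ 2 / 2) * (η ^ 2 * σ ^ 2))))
      = 4 / 7 * (K * η) ^ 2 * (σ ^ 2 / K) := by
    rw [hc, card_localSteps]
    field_simp
    ring
  rw [h3] at h2
  simp only [integral_const, probReal_univ, one_smul]
  linarith

theorem memLp_mean_local (hF : FreshSamples H Pr ν x s) (hf : ∀ i, IsSmooth β (f i))
    (hg : ∀ i, IsStochasticGradient (ν i) (f i) (g i) σ) (K : ℕ) :
    MemLp (fun ω => (1 / (N : ℝ)) • ∑ i, sgd (g i) η (fun l => s i l ω) (x ω) K) 2 Pr :=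
  (memLp_finsetSum Finset.univ fun i _ => hF.memLp_local (η := η) hf hg i K).const_smul
    (1 / (N : ℝ))

/-- Progress of one noise-free round of federated averaging with effective step size `h = K η`. -/
theorem integral_norm_mean_local_sub_sq_le (hF : FreshSamples H Pr ν x s) (hN : 0 < N)
    (hf : ∀ i, IsSmooth β (f i)) (hc : ∀ i, StrongConvexOn Set.univ μ (f i))
    (hg : ∀ i, IsStochasticGradient (ν i) (f i) (g i) σ)
    (hβ : 0 < β) (hμ : 0 < μ) (hμβ : μ ≤ β) (hη : 0 < η) {K : ℕ} (hK : 0 < K) {G B : ℝ}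
    (hB : 1 ≤ B) (hstep : K * η * β * (8 * (1 + B ^ 2)) ≤ 1)
    (hdiss : BoundedDissimilarity f G B) {z : Vec d} (hz : ∀ y, globalLoss f z ≤ globalLoss f y) :
    ∫ ω, ‖(1 / (N : ℝ)) • ∑ i, sgd (g i) η (fun l => s i l ω) (x ω) K - z‖ ^ 2 ∂Pr
      ≤ (1 - μ * (K * η) / 2) * ∫ ω, ‖x ω - z‖ ^ 2 ∂Pr
        - 29 / 20 * (K * η) * (∫ ω, (globalLoss f (x ω) - globalLoss f z) ∂Pr)
        + (17 / 10 * (σ ^ 2 * (1 + N) / (K * N)) * (K * η) ^ 2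
          + 23 / 25 * (β * G ^ 2) * (K * η) ^ 3) := by
  have hK' : (0 : ℝ) < K := by exact_mod_cast hK
  have hN' : (0 : ℝ) < N := by exact_mod_cast hN
  set h : ℝ := K * η with hh
  have hh0 : 0 < h := by positivity
  have hβh0 : 0 < h * β := by positivity
  have hβh : h * β ≤ 1 / 16 := by nlinarith
  set n : ℝ := ((localSteps N K).card : ℝ) with hn
  set Y : Fin N × ℕ → Ω → Vec d := fun p ω =>
    sgd (g p.1) η (fun l => s p.1 l ω) (x ω) p.2 with hY
  set ζ : Ω → Vec d := fun ω => (1 / n) • ∑ p ∈ localSteps N K,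
    (g p.1 (Y p ω) (s p.1 p.2 ω) - ∇ (f p.1) (Y p ω)) with hζ
  set D : Ω → ℝ := fun ω => 1 / n * ∑ p ∈ localSteps N K, ‖Y p ω - x ω‖ ^ 2 with hD
  set Δ : Ω → ℝ := fun ω => globalLoss f (x ω) - globalLoss f z with hΔ
  have hFs : IsSmooth β (globalLoss f) := IsSmooth.globalLoss hN hf
  have hx2 : MemLp (fun ω => x ω - z) 2 Pr := hF.memLp_start.sub (memLp_const z)
  have hY2 : ∀ p, MemLp (Y p) 2 Pr := fun p => hF.memLp_local (η := η) hf hg p.1 p.2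
  have hζ2 : MemLp ζ 2 Pr := by
    have := memLp_finsetSum (localSteps N K)
      fun p _ => (hF.error_moments (η := η) hf hg p.1 p.2).1
    exact this.const_smul (1 / n)
  have hxi : Integrable (fun ω => ‖x ω - z‖ ^ 2) Pr := integrable_norm_sq_of_memLp_two hx2
  have hDi : Integrable D Pr := by
    have := integrable_finsetSum (localSteps N K) fun p _ =>
      integrable_norm_sq_of_memLp_two ((hY2 p).sub hF.memLp_start)
    exact this.const_mul (1 / n)
  have hΔi : Integrable Δ Pr :=
    (hFs.integrable_comp hβ hz hF.memLp_start).sub (integrable_const _)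
  have hζi : Integrable (fun ω => ‖ζ ω‖ ^ 2) Pr := integrable_norm_sq_of_memLp_two hζ2
  have hζxi : Integrable (fun ω => (inner ℝ (ζ ω) (x ω - z) : ℝ)) Pr :=
    integrable_inner_of_memLp_two hζ2 hx2
  have hpt : ∀ ω, ‖(1 / (N : ℝ)) • ∑ i, sgd (g i) η (fun l => s i l ω) (x ω) K - z‖ ^ 2
      ≤ (1 - μ * h / 2) * ‖x ω - z‖ ^ 2 + (-(3 / 2) * h) * Δ ω + (9 / 4 * (h * β)) * D ω
        + (2 * h ^ 2) * ‖ζ ω‖ ^ 2 + (-2 * h) * inner ℝ (ζ ω) (x ω - z) := fun ω =>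
    norm_mean_local_sub_sq_le hN hf hc hβ hμ hμβ hη hK hβh hz (x ω) (fun i l => s i l ω)
      (Y := fun p => Y p ω) (fun _ => rfl) rfl rfl
  have hyi : Integrable (fun ω =>
      ‖(1 / (N : ℝ)) • ∑ i, sgd (g i) η (fun l => s i l ω) (x ω) K - z‖ ^ 2) Pr :=
    integrable_norm_sq_of_memLp_two ((hF.memLp_mean_local (η := η) hf hg K).sub (memLp_const z))
  have i1 := hxi.const_mul (1 - μ * h / 2)
  have i2 := hΔi.const_mul (-(3 / 2) * h)
  have i3 := hDi.const_mul (9 / 4 * (h * β))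
  have i4 := hζi.const_mul (2 * h ^ 2)
  have i5 := hζxi.const_mul (-2 * h)
  have hmono := integral_mono hyi ((((i1.add i2).add i3).add i4).add i5) hpt
  rw [integral_add' (((i1.add i2).add i3).add i4) i5, integral_add' ((i1.add i2).add i3) i4,
    integral_add' (i1.add i2) i3, integral_add' i1 i2, integral_const_mul (1 - μ * h / 2),
    integral_const_mul (-(3 / 2) * h), integral_const_mul (9 / 4 * (h * β)),
    integral_const_mul (2 * h ^ 2), integral_const_mul (-2 * h)] at hmono
  -- the gradient errors are orthogonal to the starting point
  have hcross : ∫ ω, (inner ℝ (ζ ω) (x ω - z) : ℝ) ∂Pr = 0 := by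
    have e1 : ∀ ω, (inner ℝ (ζ ω) (x ω - z) : ℝ) = 1 / n * ∑ p ∈ localSteps N K,
        inner ℝ (g p.1 (Y p ω) (s p.1 p.2 ω) - ∇ (f p.1) (Y p ω)) (x ω - z) := by
      intro ω
      rw [hζ, real_inner_smul_left, sum_inner]
    simp_rw [e1]
    rw [integral_const_mul, integral_finsetSum _ fun p _ =>
      integrable_inner_of_memLp_two (hF.error_moments (η := η) hf hg p.1 p.2).1 hx2]
    rw [Finset.sum_eq_zero, mul_zero]
    intro p _
    exact (hF.error_moments (η := η) hf hg p.1 p.2).2.2 _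
      ((hF.measurable_start_otherInfo p.1 p.2).sub measurable_const) hx2
  have hnoise : ∫ ω, ‖ζ ω‖ ^ 2 ∂Pr ≤ σ ^ 2 / n :=
    hF.integral_norm_mean_error_sq_le hf hg K
  have hdrift : ∫ ω, D ω ∂Pr ≤ 68 / 7 * h ^ 2 * (σ ^ 2 / K) + 17 / 42 * h ^ 2 *
      (G ^ 2 + B ^ 2 * (2 * β * ∫ ω, Δ ω ∂Pr)) :=
    hF.integral_mean_drift_le hN hf hg hβ hη.le hK (by rw [← mul_assoc]; exact hβh) hdiss hz
  have hΔ0 : 0 ≤ ∫ ω, Δ ω ∂Pr := integral_nonneg fun ω => sub_nonneg.2 (hz _)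
  rw [hcross, mul_zero, add_zero] at hmono
  rw [hn, card_localSteps] at hnoise
  exact round_arithmetic (by exact_mod_cast hN) hK' hh0 hβ hB hstep hΔ0 hmono hnoise hdrift

end FreshSamples

end Round

/-! ### The information structure of the system -/

section System

variable {Ω Ξ : Type*} {N d : ℕ}

namespace OTASystem

/-- The `σ`-algebra generated by the samples with index in `A` and the noise of the rounds
in `Q`. -/
@[reducible]
def sourceInfo [MeasurableSpace Ξ] (S : OTASystem Ω Ξ N d) (A : Set (ℕ × Fin N × ℕ))
    (Q : Set ℕ) : MeasurableSpace Ω :=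
  (⨆ t ∈ A, MeasurableSpace.comap (S.ξ t.1 t.2.1 t.2.2) inferInstance) ⊔
    ⨆ q ∈ Q, MeasurableSpace.comap (S.w q) inferInstance

/-- The samples and the noise of the rounds up to `r`. -/
@[reducible]
def past [MeasurableSpace Ξ] (S : OTASystem Ω Ξ N d) (r : ℕ) : MeasurableSpace Ω :=
  S.sourceInfo {t | t.1 ≤ r} {q | q ≤ r}

/-- All samples, and the noise of the rounds up to `r`. -/
@[reducible]
def preNoise [MeasurableSpace Ξ] (S : OTASystem Ω Ξ N d) (r : ℕ) : MeasurableSpace Ω :=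
  S.sourceInfo Set.univ {q | q ≤ r}

theorem sourceInfo_mono [MeasurableSpace Ξ] (S : OTASystem Ω Ξ N d)
    {A A' : Set (ℕ × Fin N × ℕ)} {Q Q' : Set ℕ} (hA : A ⊆ A') (hQ : Q ⊆ Q') :
    S.sourceInfo A Q ≤ S.sourceInfo A' Q' :=
  sup_le_sup (biSup_mono fun _ h => hA h) (biSup_mono fun _ h => hQ h)

theorem past_mono [MeasurableSpace Ξ] (S : OTASystem Ω Ξ N d) {q r : ℕ} (h : q ≤ r) :
    S.past q ≤ S.past r :=
  S.sourceInfo_mono (fun _ ht => le_trans ht h) fun _ hq => le_trans hq h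

theorem measurable_sample_sourceInfo [MeasurableSpace Ξ] (S : OTASystem Ω Ξ N d)
    {A : Set (ℕ × Fin N × ℕ)} {Q : Set ℕ} {r : ℕ} {i : Fin N} {k : ℕ} (h : (r, i, k) ∈ A) :
    Measurable[S.sourceInfo A Q] (S.ξ r i k) := by
  rw [measurable_iff_comap_le]
  exact le_sup_of_le_left (le_iSup₂_of_le (r, i, k) h le_rfl)

theorem measurable_noise_sourceInfo [MeasurableSpace Ξ] (S : OTASystem Ω Ξ N d)
    {A : Set (ℕ × Fin N × ℕ)} {Q : Set ℕ} {q : ℕ} (h : q ∈ Q) :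
    Measurable[S.sourceInfo A Q] (S.w q) := by
  rw [measurable_iff_comap_le]
  exact le_sup_of_le_right (le_iSup₂_of_le q h le_rfl)

namespace IsRandom

variable [MeasurableSpace Ξ] [mΩ : MeasurableSpace Ω] {Pr : Measure Ω} {ν : Fin N → Measure Ξ}
  {S : OTASystem Ω Ξ N d}

theorem iSup_sample_le (hS : S.IsRandom Pr ν) (A : Set (ℕ × Fin N × ℕ)) :
    ⨆ t ∈ A, MeasurableSpace.comap (S.ξ t.1 t.2.1 t.2.2) inferInstance ≤ mΩ :=
  iSup₂_le fun t _ => (hS.measurable_sample t.1 t.2.1 t.2.2).comap_le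

theorem iSup_noise_le (hS : S.IsRandom Pr ν) (Q : Set ℕ) :
    ⨆ q ∈ Q, MeasurableSpace.comap (S.w q) inferInstance ≤ mΩ :=
  iSup₂_le fun q _ => (hS.measurable_noise q).comap_le

theorem sourceInfo_le (hS : S.IsRandom Pr ν) (A : Set (ℕ × Fin N × ℕ)) (Q : Set ℕ) :
    S.sourceInfo A Q ≤ mΩ :=
  sup_le (hS.iSup_sample_le A) (hS.iSup_noise_le Q)

theorem indep_iSup_sample_iSup_noise (hS : S.IsRandom Pr ν) (A : Set (ℕ × Fin N × ℕ))
    (Q : Set ℕ) :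
    Indep (⨆ t ∈ A, MeasurableSpace.comap (S.ξ t.1 t.2.1 t.2.2) inferInstance)
      (⨆ q ∈ Q, MeasurableSpace.comap (S.w q) inferInstance) Pr := by
  have h := hS.samples_noise_indep
  rw [IndepFun_iff_Indep] at h
  refine indep_of_indep_of_le h (iSup₂_le fun t _ => ?_) (iSup₂_le fun q _ => ?_)
  · exact ((measurable_pi_apply (X := fun _ => Ξ) t).comp
      (comap_measurable fun ω (t : ℕ × Fin N × ℕ) => S.ξ t.1 t.2.1 t.2.2 ω)).comap_le
  · exact ((measurable_pi_apply (X := fun _ => Vec d) q).comp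
      (comap_measurable fun ω r => S.w r ω)).comap_le

theorem indep_sample (hS : S.IsRandom Pr ν) [IsProbabilityMeasure Pr]
    {A : Set (ℕ × Fin N × ℕ)} {Q : Set ℕ} {r : ℕ} {i : Fin N} {k : ℕ} (h : (r, i, k) ∉ A) :
    Indep (MeasurableSpace.comap (S.ξ r i k) inferInstance) (S.sourceInfo A Q) Pr := by
  have h1 := indep_iSup_of_disjoint (fun t => (hS.measurable_sample t.1 t.2.1 t.2.2).comap_le)
    hS.samples_indep.iIndep (S := {(r, i, k)}) (T := A) (Set.disjoint_singleton_left.2 h)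
  rw [iSup_singleton] at h1
  refine indep_sup_right_of_indep_sup_left (hS.measurable_sample r i k).comap_le
    (hS.iSup_sample_le A) (hS.iSup_noise_le Q) h1 ?_
  refine indep_of_indep_of_le_left (hS.indep_iSup_sample_iSup_noise Set.univ Q) (sup_le ?_ ?_)
  · exact le_iSup₂_of_le (r, i, k) (Set.mem_univ _) le_rfl
  · exact biSup_mono fun _ _ => Set.mem_univ _

theorem indep_noise (hS : S.IsRandom Pr ν) [IsProbabilityMeasure Pr]
    {A : Set (ℕ × Fin N × ℕ)} {Q : Set ℕ} {q : ℕ} (h : q ∉ Q) :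
    Indep (MeasurableSpace.comap (S.w q) inferInstance) (S.sourceInfo A Q) Pr := by
  have h1 := indep_iSup_of_disjoint (fun q => (hS.measurable_noise q).comap_le)
    hS.noise_indep.iIndep (S := {q}) (T := Q) (Set.disjoint_singleton_left.2 h)
  rw [iSup_singleton] at h1
  rw [sourceInfo, sup_comm]
  refine indep_sup_right_of_indep_sup_left (hS.measurable_noise q).comap_le
    (hS.iSup_noise_le Q) (hS.iSup_sample_le A) h1 ?_
  refine (indep_of_indep_of_le_right (hS.indep_iSup_sample_iSup_noise A Set.univ)
    (sup_le ?_ ?_)).symm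
  · exact le_iSup₂_of_le q (Set.mem_univ _) le_rfl
  · exact biSup_mono fun _ _ => Set.mem_univ _

theorem freshSamples (hS : S.IsRandom Pr ν) [IsProbabilityMeasure Pr] {r : ℕ} {x : Ω → Vec d}
    (hx : Measurable[S.past r] x) (hx2 : MemLp x 2 Pr) :
    FreshSamples (S.past r) Pr ν x (S.ξ (r + 1)) where
  le := hS.sourceInfo_le _ _
  measurable_start := hx
  memLp_start := hx2
  measurable := hS.measurable_sample (r + 1)
  law := hS.sample_law (r + 1)
  indep i k := by
    refine indep_of_indep_of_le_right (hS.indep_sample (A := {t | t ≠ (r + 1, i, k)})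
      (Q := Set.univ) (by simp)) (sup_le ?_ (iSup₂_le fun p hp => ?_))
    · refine S.sourceInfo_mono (fun t ht => ?_) (Set.subset_univ _)
      rintro rfl
      have : r + 1 ≤ r := ht
      omega
    · have hmem : (r + 1, p.1, p.2) ∈ {t : ℕ × Fin N × ℕ | t ≠ (r + 1, i, k)} := by
        intro he
        exact hp (Prod.ext (congrArg (fun t => t.2.1) he) (congrArg (fun t => t.2.2) he))
      exact (S.measurable_sample_sourceInfo hmem).comap_le

theorem noise_moments (hS : S.IsRandom Pr ν) [IsProbabilityMeasure Pr] (r : ℕ) :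
    MemLp (S.w r) 2 Pr ∧ (∀ m, ∫ ω, S.w r ω m ∂Pr = 0) ∧ ∫ ω, S.w r ω ∂Pr = 0 ∧
      ∫ ω, ‖S.w r ω‖ ^ 2 ∂Pr = d * (S.σw : ℝ) ^ 2 := by
  have := gaussian_moments (hS.measurable_noise r) (hS.noise_law r)
  simpa using this

end IsRandom

end OTASystem

/-! ### The broadcast estimate -/

theorem GaussianPrior.avgVar_nonneg (p : GaussianPrior Ω N d) (r : ℕ) : 0 ≤ p.avgVar r := by
  unfold GaussianPrior.avgVar; positivity

/-- Replacing `u` by its noisy observation `u + n`, shrunk by the factor `A / (A + τ)`, does not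
increase the second moment of `a + u` when `a`, `u`, `n` are orthogonal in `L²` and `u`, `n` have
second moments proportional to `A`, `τ`. If `A + τ = 0` the factor is `0` by the convention for
division, and the claim still holds because then `u = 0`. -/
theorem integral_norm_add_shrink_sq_le [MeasurableSpace Ω] {Pr : Measure Ω} {a u n : Ω → Vec d}
    (ha : MemLp a 2 Pr) (hu : MemLp u 2 Pr) (hn : MemLp n 2 Pr)
    (hua : ∫ ω, inner ℝ (u ω) (a ω) ∂Pr = 0) (hna : ∫ ω, inner ℝ (n ω) (a ω) ∂Pr = 0)
    (hnu : ∫ ω, inner ℝ (n ω) (u ω) ∂Pr = 0) {A τ : ℝ} (hA : 0 ≤ A) (hτ : 0 ≤ τ)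
    (hu2 : ∫ ω, ‖u ω‖ ^ 2 ∂Pr = d * A) (hn2 : ∫ ω, ‖n ω‖ ^ 2 ∂Pr = d * τ) :
    ∫ ω, ‖a ω + (A / (A + τ)) • (u ω + n ω)‖ ^ 2 ∂Pr ≤ ∫ ω, ‖a ω + u ω‖ ^ 2 ∂Pr := by
  set s : ℝ := A / (A + τ) with hs
  have hs1 : s * (A + τ) = A := by
    rcases (add_nonneg hA hτ).eq_or_lt with h | h
    · rw [← h, mul_zero]; linarith
    · exact div_mul_cancel₀ _ h.ne'
  have hs0 : s ≤ 1 := div_le_one_of_le₀ (by linarith) (by linarith)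
  have hsn : 0 ≤ s := by positivity
  have hun : MemLp (fun ω => u ω + n ω) 2 Pr := hu.add hn
  have hsun : MemLp (fun ω => s • (u ω + n ω)) 2 Pr := hun.const_smul s
  have e1 : ∫ ω, inner ℝ (a ω) (s • (u ω + n ω)) ∂Pr = 0 := by
    have : ∀ ω, (inner ℝ (a ω) (s • (u ω + n ω)) : ℝ)
        = s * inner ℝ (u ω) (a ω) + s * inner ℝ (n ω) (a ω) := fun ω => by
      rw [inner_smul_right, inner_add_right, real_inner_comm (u ω), real_inner_comm (n ω)]; ring
    simp_rw [this]
    rw [integral_add ((integrable_inner_of_memLp_two hu ha).const_mul s)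
      ((integrable_inner_of_memLp_two hn ha).const_mul s), integral_const_mul, integral_const_mul,
      hua, hna]
    simp
  have e2 : ∫ ω, ‖s • (u ω + n ω)‖ ^ 2 ∂Pr = s ^ 2 * (d * A + d * τ) := by
    have : ∀ ω, ‖s • (u ω + n ω)‖ ^ 2 = s ^ 2 * ‖u ω + n ω‖ ^ 2 := fun ω => by
      rw [norm_smul, mul_pow, Real.norm_eq_abs, sq_abs]
    simp_rw [this]
    rw [integral_const_mul, integral_norm_add_sq hu hn, hu2, hn2]
    have e0 : ∫ ω, inner ℝ (u ω) (n ω) ∂Pr = 0 := by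
      simp_rw [fun ω => real_inner_comm (n ω) (u ω)]
      exact hnu
    rw [e0]; ring
  have e3 : ∫ ω, inner ℝ (a ω) (u ω) ∂Pr = 0 := by
    simp_rw [fun ω => real_inner_comm (u ω) (a ω)]
    exact hua
  rw [integral_norm_add_sq ha hsun, integral_norm_add_sq ha hu, e1, e2, e3, hu2]
  have e4 : s ^ 2 * (d * A + d * τ) = s * (d * A) := by
    calc s ^ 2 * (d * A + d * τ) = s * d * (s * (A + τ)) := by ring
      _ = s * (d * A) := by rw [hs1]; ring
  have e5 : s * (d * A) ≤ 1 * (d * A) := by gcongr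
  linarith

namespace OTASystem

variable [mΩ : MeasurableSpace Ω] {Pr : Measure Ω} {S : OTASystem Ω Ξ N d} {η : ℝ}
  {p : GaussianPrior Ω N d} {R : ℕ}

theorem precoder_nonneg (hP : 0 < S.P) (x : Ω → Vec d) (r : ℕ) : 0 ≤ S.precoder Pr η x r :=
  div_nonneg hP.le (Real.iSup_nonneg fun _ => integral_nonneg fun _ => by positivity)

theorem maxChannelErr_nonneg (hP : 0 < S.P) : 0 ≤ S.maxChannelErr Pr η p R := by
  refine Real.iSup_nonneg fun r => ?_
  have h1 := precoder_nonneg (Pr := Pr) (η := η) hP (S.model Pr η p r) (r + 1)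
  have h2 := p.avgVar_nonneg (r + 1)
  simp only [channelErr, Nat.add_sub_cancel]
  positivity

/-- The rescaled channel output is the average local model plus rescaled noise. If the precoder
vanishes then no user moves, almost surely, and the identity holds because both sides equal the
starting point. -/
theorem rescaled_ae_eq (hN : 0 < N) (hP : 0 < S.P) {x : Ω → Vec d} (hx : MemLp x 2 Pr) {r : ℕ}
    (hloc : ∀ i, MemLp (S.localIter η x r i S.K) 2 Pr) :
    ∀ᵐ ω ∂Pr, S.rescaled Pr η x r ω = (1 / (N : ℝ)) • ∑ i, S.localIter η x r i S.K ω
      + (1 / ((N : ℝ) * √(S.precoder Pr η x r))) • S.w r ω := by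
  have hN' : (N : ℝ) ≠ 0 := by exact_mod_cast hN.ne'
  have hxavg : ∀ ω, (1 / (N : ℝ)) • ∑ _i : Fin N, x ω = x ω := fun ω => by
    rw [Finset.sum_const, Finset.card_univ, Fintype.card_fin, ← Nat.cast_smul_eq_nsmul ℝ,
      smul_smul, one_div_mul_cancel hN', one_smul]
  rcases eq_or_ne (S.precoder Pr η x r) 0 with h0 | h0
  · have hsup : ⨆ i : Fin N, ∫ ω, ‖S.localIter η x r i S.K ω - x ω‖ ^ 2 ∂Pr = 0 := by
      rcases div_eq_zero_iff.1 h0 with h | h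
      · exact absurd h hP.ne'
      · exact h
    have hae : ∀ i, ∀ᵐ ω ∂Pr, S.localIter η x r i S.K ω = x ω := by
      intro i
      have h1 : ∫ ω, ‖S.localIter η x r i S.K ω - x ω‖ ^ 2 ∂Pr = 0 :=
        le_antisymm (hsup ▸ le_ciSup (f := fun i : Fin N =>
          ∫ ω, ‖S.localIter η x r i S.K ω - x ω‖ ^ 2 ∂Pr) (Set.finite_range _).bddAbove i)
          (integral_nonneg fun ω => by positivity)
      have h2 : Integrable (fun ω => ‖S.localIter η x r i S.K ω - x ω‖ ^ 2) Pr :=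
        integrable_norm_sq_of_memLp_two ((hloc i).sub hx)
      rw [integral_eq_zero_iff_of_nonneg (fun ω => by positivity) h2] at h1
      filter_upwards [h1] with ω hω
      exact sub_eq_zero.1 (norm_eq_zero.1 (pow_eq_zero_iff two_ne_zero |>.1 hω))
    filter_upwards [ae_all_iff.2 hae] with ω hω
    simp only [hω, hxavg]
    simp [rescaled, h0]
  · refine Filter.Eventually.of_forall fun ω => ?_
    have hpos : √(S.precoder Pr η x r) ≠ 0 :=
      (Real.sqrt_pos.2 ((precoder_nonneg hP x r).lt_of_ne h0.symm)).ne'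
    rw [rescaled, received, ← Finset.smul_sum, smul_add, smul_smul, Finset.sum_sub_distrib,
      smul_sub]
    have h1 : 1 / ((N : ℝ) * √(S.precoder Pr η x r)) * √(S.precoder Pr η x r) = 1 / N := by
      field_simp
    rw [h1, hxavg]
    abel

variable [MeasurableSpace Ξ] {ν : Fin N → Measure Ξ}

/-- The information available at the start of round `r + 1` is determined by the past, if the
broadcast models are. -/
theorem PriorCorrect.info_le_past (hp : S.PriorCorrect Pr η p R) {r : ℕ} (hr : r + 1 ≤ R)
    (hm : ∀ q ≤ r, Measurable[S.past q] (S.model Pr η p q)) : p.info (r + 1) ≤ S.past r := by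
  refine (hp.info_le (r + 1) (Finset.mem_Icc.2 ⟨by omega, hr⟩)).trans
    (iSup₂_le fun q hq => ?_)
  have hq' : q ≤ r := Nat.lt_succ_iff.1 (Finset.mem_range.1 hq)
  exact (hm q hq').comap_le.trans (S.past_mono hq')

theorem model_measurable_memLp [IsProbabilityMeasure Pr] (hS : S.IsRandom Pr ν)
    {f : Fin N → Vec d → ℝ} {β σ : ℝ} (hf : ∀ i, IsSmooth β (f i))
    (hg : ∀ i, IsStochasticGradient (ν i) (f i) (S.g i) σ) (hp : S.PriorCorrect Pr η p R)
    {r : ℕ} (hr : r ≤ R) :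
    Measurable[S.past r] (S.model Pr η p r) ∧ MemLp (S.model Pr η p r) 2 Pr := by
  induction r using Nat.strong_induction_on with
  | _ r ih =>
    cases r with
    | zero => exact ⟨measurable_const, memLp_const _⟩
    | succ r =>
      have hm : ∀ q ≤ r, Measurable[S.past q] (S.model Pr η p q) :=
        fun q hq => (ih q (by omega) (by omega)).1
      have hinfo := hp.info_le_past hr hm
      have hmem : r + 1 ∈ Finset.Icc 1 R := Finset.mem_Icc.2 ⟨by omega, hr⟩
      have hpast : S.past r ≤ S.past (r + 1) := S.past_mono (Nat.le_succ r)
      have hle : ∀ q, S.past q ≤ mΩ := fun q => hS.sourceInfo_le _ _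
      obtain ⟨hx, hx2⟩ := ih r (by omega) (by omega)
      have hF := hS.freshSamples hx hx2
      have hmean : ∀ i, Measurable[S.past r] (p.mean (r + 1) i) := fun i =>
        (hp.measurable_mean _ hmem i).mono hinfo le_rfl
      have hloc : ∀ i, Measurable[S.past (r + 1)]
          (S.localIter η (S.model Pr η p r) (r + 1) i S.K) := fun i =>
        measurable_sgd (hg i).measurable (hx.mono hpast le_rfl) fun l _ =>
          S.measurable_sample_sourceInfo (le_refl (r + 1))
      have hloc2 : ∀ i, MemLp (S.localIter η (S.model Pr η p r) (r + 1) i S.K) 2 Pr :=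
        fun i => hF.memLp_local hf hg i S.K
      have hmean2 : ∀ i, MemLp (p.mean (r + 1) i) 2 Pr := by
        intro i
        have hU := gaussian_moments (((hloc i).mono (hle _) le_rfl).sub
          ((hmean i).mono (hle _) le_rfl)) (hp.gaussian _ hmem i)
        exact ((hloc2 i).sub hU.1).ae_eq (Filter.Eventually.of_forall fun ω => by simp)
      have havg : Measurable[S.past r] (p.avgMean (r + 1)) :=
        (Finset.measurable_fun_sum Finset.univ fun i _ => hmean i).const_smul (1 / (N : ℝ))
      have havg2 : MemLp (p.avgMean (r + 1)) 2 Pr :=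
        (memLp_finsetSum Finset.univ fun i _ => hmean2 i).const_smul (1 / (N : ℝ))
      have hrec : Measurable[S.past (r + 1)] (S.received Pr η (S.model Pr η p r) (r + 1)) := by
        have h1 : ∀ i ∈ Finset.univ, Measurable[S.past (r + 1)] fun ω =>
            √(S.precoder Pr η (S.model Pr η p r) (r + 1)) •
              (S.localIter η (S.model Pr η p r) (r + 1) i S.K ω - S.model Pr η p r ω) :=
          fun i _ => ((hloc i).sub (hx.mono hpast le_rfl)).const_smul
            (√(S.precoder Pr η (S.model Pr η p r) (r + 1)))
        exact (Finset.measurable_fun_sum _ h1).add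
          (S.measurable_noise_sourceInfo (le_refl (r + 1)))
      have hrec2 : MemLp (S.received Pr η (S.model Pr η p r) (r + 1)) 2 Pr := by
        have h1 : ∀ i ∈ Finset.univ, MemLp (fun ω =>
            √(S.precoder Pr η (S.model Pr η p r) (r + 1)) •
              (S.localIter η (S.model Pr η p r) (r + 1) i S.K ω - S.model Pr η p r ω)) 2 Pr :=
          fun i _ => ((hloc2 i).sub hx2).const_smul
            (√(S.precoder Pr η (S.model Pr η p r) (r + 1)))
        exact (memLp_finsetSum _ h1).add (hS.noise_moments (r + 1)).1
      have hres : Measurable[S.past (r + 1)]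
          (S.rescaled Pr η (S.model Pr η p r) (r + 1)) :=
        (hrec.const_smul (1 / ((N : ℝ) * √(S.precoder Pr η (S.model Pr η p r) (r + 1))))).add
          (hx.mono hpast le_rfl)
      have hres2 : MemLp (S.rescaled Pr η (S.model Pr η p r) (r + 1)) 2 Pr :=
        (hrec2.const_smul (1 / ((N : ℝ) * √(S.precoder Pr η (S.model Pr η p r) (r + 1))))).add hx2
      exact ⟨(havg.mono hpast le_rfl).add ((hres.sub (havg.mono hpast le_rfl)).const_smul
          (S.shrink Pr η p (S.model Pr η p r) (r + 1))),
        havg2.add ((hres2.sub havg2).const_smul (S.shrink Pr η p (S.model Pr η p r) (r + 1)))⟩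

/-- The broadcast estimate is, in mean square, at least as close to any point `z` as the exact
average of the local models: the MMSE estimation error is orthogonal to the estimate, so that the
channel noise is more than compensated by the shrinkage. -/
theorem integral_norm_model_succ_sub_sq_le [IsProbabilityMeasure Pr] (hS : S.IsRandom Pr ν)
    (hN : 0 < N) (hP : 0 < S.P) {f : Fin N → Vec d → ℝ} {β σ : ℝ} (hf : ∀ i, IsSmooth β (f i))
    (hg : ∀ i, IsStochasticGradient (ν i) (f i) (S.g i) σ) (hp : S.PriorCorrect Pr η p R)
    {r : ℕ} (hr : r + 1 ≤ R) (z : Vec d) :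
    ∫ ω, ‖S.model Pr η p (r + 1) ω - z‖ ^ 2 ∂Pr
      ≤ ∫ ω, ‖(1 / (N : ℝ)) • ∑ i, S.localIter η (S.model Pr η p r) (r + 1) i S.K ω - z‖ ^ 2
        ∂Pr := by
  have hN' : (N : ℝ) ≠ 0 := by exact_mod_cast hN.ne'
  have hm : ∀ q ≤ r, Measurable[S.past q] (S.model Pr η p q) :=
    fun q hq => (model_measurable_memLp hS hf hg hp (hq.trans (by omega))).1
  have hinfo := hp.info_le_past hr hm
  have hmem : r + 1 ∈ Finset.Icc 1 R := Finset.mem_Icc.2 ⟨by omega, hr⟩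
  obtain ⟨hx, hx2⟩ := model_measurable_memLp hS hf hg hp (r := r) (by omega)
  set x := S.model Pr η p r with hxdef
  have hF := hS.freshSamples hx hx2
  have hHle : S.preNoise r ≤ mΩ := hS.sourceInfo_le _ _
  have hpastH : S.past r ≤ S.preNoise r := S.sourceInfo_mono (Set.subset_univ _) subset_rfl
  set θ : Fin N → Ω → Vec d := fun i => S.localIter η x (r + 1) i S.K with hθ
  have hθm : ∀ i, Measurable[S.preNoise r] (θ i) := fun i =>
    measurable_sgd (hg i).measurable (hx.mono hpastH le_rfl) fun l _ =>
      S.measurable_sample_sourceInfo (Set.mem_univ _)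
  have hθ2 : ∀ i, MemLp (θ i) 2 Pr := fun i => hF.memLp_local hf hg i S.K
  have hmean : ∀ i, Measurable[p.info (r + 1)] (p.mean (r + 1) i) :=
    fun i => hp.measurable_mean _ hmem i
  have hmeanH : ∀ i, Measurable[S.preNoise r] (p.mean (r + 1) i) :=
    fun i => (hmean i).mono (hinfo.trans hpastH) le_rfl
  -- the innovations of the users
  set u : Fin N → Ω → Vec d := fun i ω => θ i ω - p.mean (r + 1) i ω with hu
  have huH : ∀ i, Measurable[S.preNoise r] (u i) := fun i => (hθm i).sub (hmeanH i)
  have hum : ∀ i, MemLp (u i) 2 Pr ∧ (∀ m, ∫ ω, u i ω m ∂Pr = 0) ∧ ∫ ω, u i ω ∂Pr = 0 ∧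
      ∫ ω, ‖u i ω‖ ^ 2 ∂Pr = d * p.var (r + 1) i := fun i =>
    gaussian_moments ((huH i).mono hHle le_rfl) (hp.gaussian _ hmem i)
  have hmean2 : ∀ i, MemLp (p.mean (r + 1) i) 2 Pr := fun i =>
    ((hθ2 i).sub (hum i).1).ae_eq (Filter.Eventually.of_forall fun ω => by simp [hu])
  have havgI : Measurable[p.info (r + 1)] (p.avgMean (r + 1)) :=
    (Finset.measurable_fun_sum Finset.univ fun i _ => hmean i).const_smul (1 / (N : ℝ))
  have havg2 : MemLp (p.avgMean (r + 1)) 2 Pr :=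
    (memLp_finsetSum Finset.univ fun i _ => hmean2 i).const_smul (1 / (N : ℝ))
  set a : Ω → Vec d := fun ω => p.avgMean (r + 1) ω - z with ha
  have haI : Measurable[p.info (r + 1)] a := havgI.sub measurable_const
  have haH : Measurable[S.preNoise r] a := haI.mono (hinfo.trans hpastH) le_rfl
  have ha2 : MemLp a 2 Pr := havg2.sub (memLp_const z)
  set U : Ω → Vec d := fun ω => (1 / (N : ℝ)) • ∑ i, u i ω with hU
  have hUH : Measurable[S.preNoise r] U :=
    (Finset.measurable_fun_sum Finset.univ fun i _ => huH i).const_smul (1 / (N : ℝ))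
  have hU2 : MemLp U 2 Pr :=
    (memLp_finsetSum Finset.univ fun i _ => (hum i).1).const_smul (1 / (N : ℝ))
  set α := S.precoder Pr η x (r + 1) with hα
  have hα0 : 0 ≤ α := precoder_nonneg hP x (r + 1)
  set c : ℝ := 1 / ((N : ℝ) * √α) with hc
  set n : Ω → Vec d := fun ω => c • S.w (r + 1) ω with hn
  obtain ⟨hw2, -, hw0, hwsq⟩ := hS.noise_moments (Pr := Pr) (r + 1)
  have hn2 : MemLp n 2 Pr := hw2.const_smul c
  have hwH : ∀ Z : Ω → Vec d, Measurable[S.preNoise r] Z → MemLp Z 2 Pr →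
      ∫ ω, inner ℝ (n ω) (Z ω) ∂Pr = 0 := by
    intro Z hZ hZ2
    simp_rw [hn, real_inner_smul_left]
    rw [integral_const_mul, integral_inner_eq_zero_of_indep
      (hS.indep_noise (by simp)) hZ hw2 hZ2 hw0, mul_zero]
  have hUa : ∫ ω, inner ℝ (U ω) (a ω) ∂Pr = 0 := by
    simp_rw [hU, real_inner_smul_left, sum_inner]
    rw [integral_const_mul, integral_finsetSum _ fun i _ =>
      integrable_inner_of_memLp_two (hum i).1 ha2, Finset.sum_eq_zero, mul_zero]
    intro i _
    exact integral_inner_eq_zero_of_indep (hp.indep_info _ hmem i) haI (hum i).1 ha2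
      (hum i).2.2.1
  have horth : ∀ i j, i ≠ j → ∫ ω, inner ℝ (u i ω) (u j ω) ∂Pr = 0 := by
    intro i j hij
    have hLp : ∀ i m, MemLp (fun ω => u i ω m) 2 Pr := fun i m =>
      memLp_piLp_iff.1 (hum i).1 m
    simp_rw [PiLp.inner_apply]
    rw [integral_finsetSum _ fun m _ => ?_]
    · refine Finset.sum_eq_zero fun m _ => ?_
      have h1 := hp.uncorrelated _ hmem j i hij.symm m m
      have h2 := covariance_eq_sub (hLp j m) (hLp i m)
      rw [(hum j).2.1 m, zero_mul, sub_zero] at h2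
      have h3 : cov[fun ω => u j ω m, fun ω => u i ω m; Pr] = 0 := h1
      rw [h3] at h2
      exact h2.symm
    · exact (hLp j m).integrable_mul (hLp i m)
  have hUsq : ∫ ω, ‖U ω‖ ^ 2 ∂Pr = d * p.avgVar (r + 1) := by
    have h1 : ∀ ω, ‖U ω‖ ^ 2 = (1 / (N : ℝ)) ^ 2 * ‖∑ i, u i ω‖ ^ 2 := fun ω => by
      rw [hU, norm_smul, mul_pow, Real.norm_of_nonneg (by positivity)]
    simp_rw [h1]
    rw [integral_const_mul, integral_norm_sum_sq _ (fun i _ => (hum i).1)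
      fun i _ j _ hij => horth i j hij]
    simp_rw [fun i => (hum i).2.2.2]
    rw [← Finset.mul_sum, GaussianPrior.avgVar]
    ring
  have hnsq : ∫ ω, ‖n ω‖ ^ 2 ∂Pr = d * ((S.σw : ℝ) ^ 2 / (α * (N : ℝ) ^ 2)) := by
    have h1 : ∀ ω, ‖n ω‖ ^ 2 = c ^ 2 * ‖S.w (r + 1) ω‖ ^ 2 := fun ω => by
      rw [hn, norm_smul, mul_pow, Real.norm_eq_abs, sq_abs]
    simp_rw [h1]
    rw [integral_const_mul, hwsq, hc, div_pow, mul_pow, Real.sq_sqrt hα0]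
    ring
  have hmain := integral_norm_add_shrink_sq_le ha2 hU2 hn2 hUa (hwH a haH ha2)
    (hwH U hUH hU2) (p.avgVar_nonneg (r + 1)) (by positivity) hUsq hnsq
  have hUavg : ∀ ω, p.avgMean (r + 1) ω + U ω = (1 / (N : ℝ)) • ∑ i, θ i ω := fun ω => by
    simp only [hU, hu, GaussianPrior.avgMean]
    rw [← smul_add, ← Finset.sum_add_distrib]
    simp
  have e1 : ∫ ω, ‖S.model Pr η p (r + 1) ω - z‖ ^ 2 ∂Pr
      = ∫ ω, ‖a ω + (p.avgVar (r + 1) / (p.avgVar (r + 1) + (S.σw : ℝ) ^ 2 / (α * (N : ℝ) ^ 2)))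
        • (U ω + n ω)‖ ^ 2 ∂Pr := by
    refine integral_congr_ae ?_
    filter_upwards [rescaled_ae_eq hN hP hx2 hθ2] with ω hω
    have h1 : S.model Pr η p (r + 1) ω = p.avgMean (r + 1) ω
        + S.shrink Pr η p x (r + 1) • (S.rescaled Pr η x (r + 1) ω - p.avgMean (r + 1) ω) := rfl
    have h2 : S.rescaled Pr η x (r + 1) ω - p.avgMean (r + 1) ω = U ω + n ω := by
      rw [hω]
      change (1 / (N : ℝ)) • ∑ i, θ i ω + n ω - p.avgMean (r + 1) ω = U ω + n ω
      rw [← hUavg]; abel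
    rw [h1, h2, shrink, ← hα]
    congr 2
    simp only [ha]
    abel
  have e2 : ∀ ω, a ω + U ω = (1 / (N : ℝ)) • ∑ i, θ i ω - z := fun ω => by
    rw [← hUavg, ha]; simp only; abel
  rw [e1]
  simp_rw [e2] at hmain
  exact hmain

end OTASystem

end System

/-! ### The convergence rate -/

section Convergence

variable {Ω Ξ : Type*} {N d : ℕ}

theorem ConvexOn.globalLoss_weighted_average_le {f : Fin N → Vec d → ℝ}
    (hF : ConvexOn ℝ Set.univ (globalLoss f)) {s : Finset ℕ} {wt : ℕ → ℝ}
    (hwt : ∀ r ∈ s, 0 < wt r) (hs : s.Nonempty) (x : ℕ → Vec d) (c : ℝ) :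
    globalLoss f ((1 / ∑ r ∈ s, wt r) • ∑ r ∈ s, wt r • x r) - c
      ≤ (∑ r ∈ s, wt r)⁻¹ * ∑ r ∈ s, wt r * (globalLoss f (x r) - c) := by
  have hW : 0 < ∑ r ∈ s, wt r := Finset.sum_pos hwt hs
  have h1 := hF.map_sum_le (t := s) (w := fun r => wt r / ∑ r ∈ s, wt r) (p := x)
    (fun r hr => (div_pos (hwt r hr) hW).le) (by rw [← Finset.sum_div, div_self hW.ne'])
    fun _ _ => Set.mem_univ _
  have h2 : ∑ r ∈ s, (wt r / ∑ r ∈ s, wt r) • x r = (1 / ∑ r ∈ s, wt r) • ∑ r ∈ s, wt r • x r := by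
    rw [Finset.smul_sum]
    refine Finset.sum_congr rfl fun r _ => ?_
    rw [smul_smul]; congr 1; ring
  have h3 : ∑ r ∈ s, (wt r / ∑ r ∈ s, wt r) • globalLoss f (x r)
      = (∑ r ∈ s, wt r)⁻¹ * ∑ r ∈ s, wt r * globalLoss f (x r) := by
    rw [Finset.mul_sum]
    refine Finset.sum_congr rfl fun r _ => ?_
    rw [smul_eq_mul]; ring
  rw [h2, h3] at h1
  simp_rw [mul_sub]
  rw [Finset.sum_sub_distrib, ← Finset.sum_mul, mul_sub, inv_mul_cancel_left₀ hW.ne']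
  linarith

namespace OTASystem

/-- The error bound for a fixed step size `η` with effective step size `h = K η`, for the output
with weights `(1 - μ h / 2)⁻ʳ`. -/
theorem integral_output_sub_le [MeasurableSpace Ξ] [MeasurableSpace Ω] {Pr : Measure Ω}
    [IsProbabilityMeasure Pr] {ν : Fin N → Measure Ξ} {S : OTASystem Ω Ξ N d} {η : ℝ}
    {p : GaussianPrior Ω N d} {R : ℕ} (hS : S.IsRandom Pr ν) (hN : 0 < N) (hK : 0 < S.K)
    (hP : 0 < S.P) {f : Fin N → Vec d → ℝ} {β μ σ G B : ℝ} (hf : ∀ i, IsSmooth β (f i))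
    (hc : ∀ i, StrongConvexOn Set.univ μ (f i))
    (hg : ∀ i, IsStochasticGradient (ν i) (f i) (S.g i) σ) (hp : S.PriorCorrect Pr η p R)
    (hβ : 0 < β) (hμ : 0 < μ) (hμβ : μ ≤ β) (hη : 0 < η) (hB : 1 ≤ B)
    (hstep : S.K * η * β * (8 * (1 + B ^ 2)) ≤ 1) (hR : 1 ≤ μ * (S.K * η) * R)
    (hdiss : BoundedDissimilarity f G B) {z : Vec d}
    (hz : ∀ y, globalLoss f z ≤ globalLoss f y) :
    Integrable (fun ω => globalLoss f
      (S.output Pr η p R (fun r => (1 - μ * (S.K * η) / 2)⁻¹ ^ r) ω)) Pr ∧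
    ∫ ω, globalLoss f (S.output Pr η p R (fun r => (1 - μ * (S.K * η) / 2)⁻¹ ^ r) ω) ∂Pr
        - globalLoss f z
      ≤ 9 / 10 * μ * ‖S.init - z‖ ^ 2 * Real.exp (-(μ * (S.K * η) * R / 2))
        + 20 / 29 * (17 / 10 * (σ ^ 2 * (1 + N) / (S.K * N)) * (S.K * η)
          + 23 / 25 * (β * G ^ 2) * (S.K * η) ^ 2) := by
  have hK' : (0 : ℝ) < S.K := by exact_mod_cast hK
  set h : ℝ := S.K * η with hh
  have hh0 : 0 < h := by positivity
  have hβh0 : 0 < h * β := by positivity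
  have hβh : h * β ≤ 1 / 16 := by nlinarith
  have hμh : μ * h < 2 := by nlinarith
  set q : ℝ := 1 - μ * h / 2 with hq
  have hq0 : 0 < q := by linarith
  set wt : ℕ → ℝ := fun r => q⁻¹ ^ r with hwt
  have hwt0 : ∀ r, 0 < wt r := fun r => by positivity
  have hFs : IsSmooth β (globalLoss f) := IsSmooth.globalLoss hN hf
  have hFc : ConvexOn ℝ Set.univ (globalLoss f) := convexOn_globalLoss fun i =>
    strongConvexOn_zero.1 ((hc i).mono hμ.le)
  have hmodel : ∀ r ≤ R, Measurable[S.past r] (S.model Pr η p r) ∧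
      MemLp (S.model Pr η p r) 2 Pr := fun r hr => model_measurable_memLp hS hf hg hp hr
  have hFi : ∀ r ≤ R, Integrable (fun ω => globalLoss f (S.model Pr η p r ω)) Pr :=
    fun r hr => hFs.integrable_comp hβ hz (hmodel r hr).2
  set a : ℕ → ℝ := fun r => if r ≤ R then ∫ ω, ‖S.model Pr η p r ω - z‖ ^ 2 ∂Pr else 0 with ha
  set D : ℕ → ℝ := fun r => ∫ ω, (globalLoss f (S.model Pr η p r ω) - globalLoss f z) ∂Pr with hD
  set E : ℝ := 17 / 10 * (σ ^ 2 * (1 + N) / (S.K * N)) * h ^ 2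
    + 23 / 25 * (β * G ^ 2) * h ^ 3 with hE
  have ha0 : a 0 = ‖S.init - z‖ ^ 2 := by simp [ha, model]
  have han : a (R + 1) = 0 := by simp [ha]
  -- after the last broadcast, a virtual noise-free round accounts for the gap of the last model
  have hrec : ∀ r < R + 1, a (r + 1) ≤ q * a r - 29 / 20 * h * D r + E := by
    intro r hr
    have hrR : r ≤ R := Nat.lt_succ_iff.1 hr
    have hF := hS.freshSamples (hmodel r hrR).1 (hmodel r hrR).2
    have hround := hF.integral_norm_mean_local_sub_sq_le hN hf hc hg hβ hμ hμβ hη hK hB hstep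
      hdiss hz
    have har : a r = ∫ ω, ‖S.model Pr η p r ω - z‖ ^ 2 ∂Pr := if_pos hrR
    rw [har]
    refine le_trans ?_ hround
    rcases hrR.lt_or_eq with hlt | rfl
    · have har' : a (r + 1) = ∫ ω, ‖S.model Pr η p (r + 1) ω - z‖ ^ 2 ∂Pr := if_pos hlt
      rw [har']
      exact integral_norm_model_succ_sub_sq_le hS hN hP hf hg hp hlt z
    · rw [han]
      exact integral_nonneg fun ω => by positivity
  have hsum := weighted_average_le hμ hh0 hμh hR
    (by rw [ha0]; positivity) han.ge hrec
  have hEh : E / h = 17 / 10 * (σ ^ 2 * (1 + N) / (S.K * N)) * h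
      + 23 / 25 * (β * G ^ 2) * h ^ 2 := by
    rw [hE]; field_simp
  rw [ha0, hEh] at hsum
  have hidx : ∀ r ∈ Finset.Icc 1 (R + 1), r - 1 ≤ R := fun r hr => by
    have := (Finset.mem_Icc.1 hr).2; omega
  have hout2 : MemLp (S.output Pr η p R wt) 2 Pr := by
    have h1 : ∀ r ∈ Finset.Icc 1 (R + 1), MemLp (fun ω => wt r • S.model Pr η p (r - 1) ω) 2 Pr :=
      fun r hr => (hmodel _ (hidx r hr)).2.const_smul (wt r)
    exact (memLp_finsetSum _ h1).const_smul (1 / ∑ r ∈ Finset.Icc 1 (R + 1), wt r)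
  have houti : Integrable (fun ω => globalLoss f (S.output Pr η p R wt ω)) Pr :=
    hFs.integrable_comp hβ hz hout2
  refine ⟨houti, le_trans ?_ hsum⟩
  have hterm : ∀ r ∈ Finset.Icc 1 (R + 1), Integrable (fun ω =>
      wt r * (globalLoss f (S.model Pr η p (r - 1) ω) - globalLoss f z)) Pr := fun r hr =>
    ((hFi _ (hidx r hr)).sub (integrable_const _)).const_mul (wt r)
  have hjensen : ∫ ω, (globalLoss f (S.output Pr η p R wt ω) - globalLoss f z) ∂Pr
      ≤ ∫ ω, (∑ r ∈ Finset.Icc 1 (R + 1), wt r)⁻¹ * ∑ r ∈ Finset.Icc 1 (R + 1),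
        wt r * (globalLoss f (S.model Pr η p (r - 1) ω) - globalLoss f z) ∂Pr :=
    integral_mono (houti.sub (integrable_const _)) ((integrable_finsetSum _ hterm).const_mul _)
      fun ω => hFc.globalLoss_weighted_average_le (fun r _ => hwt0 r) ⟨1, by simp⟩
        (fun r => S.model Pr η p (r - 1) ω) _
  rw [integral_const_mul, integral_finsetSum _ hterm, integral_sub houti (integrable_const _)]
    at hjensen
  simp only [integral_const_mul, integral_const, probReal_univ, one_smul] at hjensen
  rw [div_eq_inv_mul]
  exact hjensen

end OTASystem

end Convergence

theorem theorem1 {Ω Ξ : Type*} [MeasurableSpace Ω] [MeasurableSpace Ξ] {N d : ℕ}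
    (Pr : Measure Ω) [IsProbabilityMeasure Pr] (ν : Fin N → Measure Ξ)
    (S : OTASystem Ω Ξ N d) (hN : 0 < N) (hK : 0 < S.K) (hP : 0 < S.P)
    (hS : S.IsRandom Pr ν)
    (f : Fin N → Vec d → ℝ) (β μ σ M G B : ℝ)
    (hβ : 0 < β) (hμ : 0 < μ) (hσ : 0 < σ) (hM : 0 < M) (hG : 0 ≤ G) (hB : 1 ≤ B)
    (R : ℕ) (hR : 8 * β * (1 + B ^ 2) / μ ≤ (R : ℝ))
    -- the prior used by the server, which may depend on the step size
    (p : ℝ → GaussianPrior Ω N d)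
    -- smoothness and strong convexity
    (hsmooth : ∀ i, IsSmooth β (f i))
    (hconvex : ∀ i, StrongConvexOn Set.univ μ (f i))
    -- unbiased stochastic gradients with bounded variance, and with bounded second moment
    -- at the points where the algorithm evaluates them
    (hgrad : ∀ i, IsStochasticGradient (ν i) (f i) (S.g i) σ)
    (hmoment : ∀ η, 0 < η → η ≤ 1 / (8 * β * S.K * (1 + B ^ 2)) →
      ∀ r ∈ Finset.Icc 1 R, ∀ i, ∀ k < S.K,
        ∫ ω, ‖S.g i (S.iterate Pr η (p η) r i k ω) (S.ξ r i k ω)‖ ^ 2 ∂Pr ≤ M ^ 2)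
    -- bounded gradient dissimilarity
    (hdiss : BoundedDissimilarity f G B)
    -- the Gaussian model of the local weights
    (hprior : ∀ η, 0 < η → η ≤ 1 / (8 * β * S.K * (1 + B ^ 2)) →
      S.PriorCorrect Pr η (p η) R)
    (xstar : Vec d) (hxstar : ∀ x, globalLoss f xstar ≤ globalLoss f x) :
    ∃ η : ℝ, 0 < η ∧ η ≤ 1 / (8 * β * S.K * (1 + B ^ 2)) ∧
    ∃ wt : ℕ → ℝ, (∀ r ∈ Finset.Icc 1 (R + 1), 0 < wt r) ∧
      Integrable (fun ω => globalLoss f (S.output Pr η (p η) R wt ω)) Pr ∧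
      (∫ ω, globalLoss f (S.output Pr η (p η) R wt ω) ∂Pr) - globalLoss f xstar ≤
        (3 * σ ^ 2 * (1 + N) / (μ * R * S.K * N)
            + 3 * d * M ^ 2 * S.maxChannelErr Pr η (p η) R / (μ * R * N ^ 2 * S.P))
          * logFactor (μ ^ 2 * R * ‖S.init - xstar‖ ^ 2 /
              (σ ^ 2 * (1 + N) / (S.K * N)
                + d * M ^ 2 * S.maxChannelErr Pr η (p η) R / (N ^ 2 * S.P)))
        + 3 * β * G ^ 2 / (μ ^ 2 * R ^ 2)
          * logFactor (μ ^ 3 * R ^ 2 * ‖S.init - xstar‖ ^ 2 / (β * G ^ 2)) ^ 2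
        + 3 * μ * ‖S.init - xstar‖ ^ 2 * Real.exp (-(μ * R) / (16 * β * (1 + B ^ 2))) := by
  have hN' : (0 : ℝ) < N := by exact_mod_cast hN
  have hK' : (0 : ℝ) < S.K := by exact_mod_cast hK
  have hB2 : 0 < 1 + B ^ 2 := by positivity
  have hR0 : (0 : ℝ) < R := lt_of_lt_of_le (by positivity) hR
  set hmax : ℝ := 1 / (8 * β * (1 + B ^ 2)) with hhmax
  have hmax0 : 0 < hmax := by positivity
  have hηmax : 1 / (8 * β * S.K * (1 + B ^ 2)) = hmax / S.K := by
    rw [hhmax]; field_simp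
  rcases d.eq_zero_or_pos with rfl | hd
  · -- the parameter space is a single point
    refine ⟨hmax / S.K, by positivity, hηmax.ge, fun _ => 1, fun _ _ => one_pos, ?_, ?_⟩
    · have : ∀ ω, S.output Pr (hmax / S.K) (p (hmax / S.K)) R (fun _ => 1) ω = xstar :=
        fun ω => Subsingleton.elim _ _
      simp_rw [this]
      exact integrable_const _
    · have : ∀ ω, S.output Pr (hmax / S.K) (p (hmax / S.K)) R (fun _ => 1) ω = xstar :=
        fun ω => Subsingleton.elim _ _
      simp_rw [this]
      have h1 := OTASystem.maxChannelErr_nonneg (Pr := Pr) (η := hmax / S.K)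
        (p := p (hmax / S.K)) (R := R) hP
      have h2 := logFactor_nonneg (μ ^ 2 * R * ‖S.init - xstar‖ ^ 2 /
              (σ ^ 2 * (1 + N) / (S.K * N)
                + (0 : ℕ) * M ^ 2 * S.maxChannelErr Pr (hmax / S.K) (p (hmax / S.K)) R
                  / (N ^ 2 * S.P)))
      simp only [integral_const, probReal_univ, one_smul, sub_self]
      positivity
  have : NeZero d := ⟨hd.ne'⟩
  have hμβ : μ ≤ β := (hconvex ⟨0, hN⟩).modulus_le (hsmooth ⟨0, hN⟩)
  have hmaxR : 1 ≤ μ * hmax * R := by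
    rw [div_le_iff₀ hμ] at hR
    rw [hhmax, mul_one_div, div_mul_eq_mul_div, le_div_iff₀ (by positivity)]
    linarith
  obtain ⟨h, hh0, hhle, hhR, hbound⟩ := exists_step_size (μ := μ) (R := R)
    (d₀ := ‖S.init - xstar‖ ^ 2) (c₁ := σ ^ 2 * (1 + N) / (S.K * N)) (c₂ := β * G ^ 2)
    (hmax := hmax) hμ hR0 (by positivity) (by positivity) (by positivity) hmaxR
  have hKη : S.K * (h / S.K) = h := by field_simp
  have hη0 : 0 < h / S.K := by positivity
  have hηle : h / S.K ≤ 1 / (8 * β * S.K * (1 + B ^ 2)) := by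
    rw [hηmax]; gcongr
  have hstep : S.K * (h / S.K) * β * (8 * (1 + B ^ 2)) ≤ 1 := by
    rw [hKη]
    have h1 : h * (8 * β * (1 + B ^ 2)) ≤ 1 := (le_div_iff₀ (by positivity)).1 hhle
    linarith
  have hμh : μ * h < 2 := by
    have h1 : h * (8 * β * (1 + B ^ 2)) ≤ 1 := (le_div_iff₀ (by positivity)).1 hhle
    have h2 : μ * h ≤ h * β := by rw [mul_comm]; gcongr
    nlinarith [mul_pos hh0 hβ, sq_nonneg B]
  obtain ⟨hint, herr⟩ := OTASystem.integral_output_sub_le hS hN hK hP hsmooth hconvex hgrad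
    (hprior (h / S.K) hη0 hηle) hβ hμ hμβ hη0 hB hstep (by rw [hKη]; exact hhR) hdiss hxstar
  refine ⟨h / S.K, hη0, hηle, fun r => (1 - μ * (S.K * (h / S.K)) / 2)⁻¹ ^ r, fun r _ => ?_,
    hint, herr.trans ?_⟩
  · have : 0 < 1 - μ * (S.K * (h / S.K)) / 2 := by rw [hKη]; linarith
    positivity
  rw [hKη]
  refine hbound.trans ?_
  -- adding the channel term to `c₁` only increases the bound
  set e := S.maxChannelErr Pr (h / S.K) (p (h / S.K)) R with he
  have he0 : 0 ≤ e := OTASystem.maxChannelErr_nonneg hP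
  have hmono := mul_logFactor_mono (b := μ ^ 2 * R * ‖S.init - xstar‖ ^ 2)
    (c := σ ^ 2 * (1 + N) / (S.K * N))
    (c' := σ ^ 2 * (1 + N) / (S.K * N) + d * M ^ 2 * e / (N ^ 2 * S.P)) (by positivity)
    (le_add_of_nonneg_right (by positivity))
  have h1 : 3 * σ ^ 2 * (1 + N) / (μ * R * S.K * N) + 3 * d * M ^ 2 * e / (μ * R * N ^ 2 * S.P)
      = 3 / (μ * R) * (σ ^ 2 * (1 + N) / (S.K * N) + d * M ^ 2 * e / (N ^ 2 * S.P)) := by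
    field_simp
  have h2 := mul_le_mul_of_nonneg_left hmono (by positivity : 0 ≤ 3 / (μ * R))
  have h3 : -(μ * hmax * R / 2) = -(μ * R) / (16 * β * (1 + B ^ 2)) := by
    rw [hhmax]; field_simp; norm_num
  have h4 : 3 * (σ ^ 2 * (1 + N) / (S.K * N)) / (μ * R)
      = 3 / (μ * R) * (σ ^ 2 * (1 + N) / (S.K * N)) := by ring
  have h5 : 3 * (β * G ^ 2) / (μ ^ 2 * R ^ 2) = 3 * β * G ^ 2 / (μ ^ 2 * R ^ 2) := by ring
  rw [h1, h3, h4, h5]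
  linarith
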